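/- Let $C$ be a field of characteristic zero, let $(\Gamma,+,0,<)$ be a non-trivial totally ordered Abelian group, and let $C((\Gamma))$ be the field of Hahn series $f:\Gamma\to C$ with well-ordered support. For $f,g\in C((\Gamma))$ write $f\preccurlyeq g$ if $f=0$, or if $f,g\neq 0$ and $\min\operatorname{supp} f\geq\min\operatorname{supp} g$. For any total quasi-ordering $\preccurlyeq$, write $f\prec g$ if $f\preccurlyeq g$ and $g\not\preccurlyeq f$, and $f\asymp g$ if $f\preccurlyeq g$ and $g\preccurlyeq f$. A map $\phi:C((\Gamma))\to C((\Gamma))$ is contracting if $\phi(h)\prec h$ for all $h\neq 0$. A family $(s_i)_{i\in I}$ in $C((\Gamma))$ is summable if $\bigcup_{i}\operatorname{supp} s_i$ is well-ordered and each $\gamma\in\Gamma$ lies in $\operatorname{supp} s_i$ for only finitely many $i$; its sum is then taken coefficientwise. A $C$-linear map is strongly linear if it sends summable families to summable families and commutes with their sums. Let $\partial$ be a strongly linear derivation on $C((\Gamma))$ with $\ker\partial=C$. Let $\operatorname{Cont}(\partial)$ be the set of all $f\in C((\Gamma))$ such that $f\partial$ is contracting, and put $[\![f,g]\!]:=f\,\partial(g)-\partial(f)\,g$.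 For $f,g\in\operatorname{Cont}(\partial)$ let $f*g:=\sum_{n\geq 1} z_n(f,g)$, where $z_n(f,g)$ is the homogeneous part of degree $n$ of the Baker–Campbell–Hausdorff series for the bracket $[\![\cdot,\cdot]\!]$, so $$f*g=f+g+\tfrac12[\![f,g]\!]+\tfrac1{12}\bigl([\![f,[\![f,g]\!]]\!]-[\![g,[\![f,g]\!]]\!]\bigr)+\cdots .$$ **Proposition.** For all $f,g\in\operatorname{Cont}(\partial)$ the family $(z_n(f,g))_{n\geq1}$ is summable and $f*g\in\operatorname{Cont}(\partial)$. Moreover $(\operatorname{Cont}(\partial),*,0,\preccurlyeq)$ is a nearly Abelian c-valued group, and it is spherically complete. Here, for a group $(\mathcal G,\cdot,1)$ with a total quasi-ordering $\preccurlyeq$, and $[f,g]:=f^{-1}g^{-1}fg$: - $\mathcal G$ is *c-valued* if for all $f,g,h\in\mathcal G$: $f\neq1\Rightarrow 1\prec f$; $fg\preccurlyeq f$ or $fg\preccurlyeq g$; $f\preccurlyeq g\Rightarrow hfh^{-1}\preccurlyeq hgh^{-1}$; $f\asymp f^{-1}$; if $f,g\neq1$ commute, then $f\asymp g$; if $f,g\neq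 1$ and $f\asymp g$, then $[f,g]\prec f$. - $\mathcal G$ is *nearly Abelian* if $[f,g]\prec f$ and $[f,g]\prec g$ for all $f,g\neq1$. - $\mathcal G$ is *spherically complete* if every family, totally ordered by inclusion, of right balls $\{h: g^{-1}h\prec r\}$ and left balls $\{h: hg^{-1}\prec r\}$ (with $g,r\in\mathcal G$, $r\neq1$) has non-empty intersection. -/

import Mathlib

namespace ValuedGroup

/-! ### Groups with dominance relations -/

section Dominance

variable {G : Type*}

/-- The strict relation `f ≺ g` of a quasi-ordering `f ≼ g`. -/
def StrictlyDominated (le : G → G → Prop) (f g : G) : Prop := le f g ∧ ¬ le g f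

/-- The equivalence relation `f ≍ g` of a quasi-ordering `f ≼ g`. -/
def SameValue (le : G → G → Prop) (f g : G) : Prop := le f g ∧ le g f

/-- A dominance relation on a group: a total quasi-ordering compatible with the group law. -/
structure IsDominance [Group G] (le : G → G → Prop) : Prop where
  refl : ∀ f, le f f
  trans : ∀ f g h, le f g → le g h → le f h
  total : ∀ f g, le f g ∨ le g f
  one_lt : ∀ f, f ≠ 1 → StrictlyDominated le 1 f
  mul_le : ∀ f g, le (f * g) f ∨ le (f * g) g
  conj_le : ∀ f g h, le f g → le (h * f * h⁻¹) (h * g * h⁻¹)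
  inv_same : ∀ f, SameValue le f f⁻¹

/-- The commutator `[f, g] = f⁻¹ g⁻¹ f g` (Mathlib's `⁅f, g⁆` is `f g f⁻¹ g⁻¹`). -/
def comm [Group G] (f g : G) : G := f⁻¹ * g⁻¹ * f * g

/-- A c-dominance relation: a dominance relation that is also compatible with centralisers and commutators. -/
structure IsCDominance [Group G] (le : G → G → Prop) : Prop extends IsDominance le where
  same_of_commute : ∀ f g, g * f = f * g → f ≠ 1 → g ≠ 1 → SameValue le g f
  comm_lt : ∀ f g, SameValue le f g → f ≠ 1 → g ≠ 1 → StrictlyDominated le (comm f g) f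

/-- Near commutativity: `[f, g] ≺ f` and `[f, g] ≺ g` for all nontrivial `f` and `g`. -/
def IsNearlyAbelian [Group G] (le : G → G → Prop) : Prop :=
  ∀ f g : G, f ≠ 1 → g ≠ 1 →
    StrictlyDominated le (comm f g) f ∧ StrictlyDominated le (comm f g) g

/-- The strict right ball with centre `g` and radius the value of `r`. -/
def rightBall [Group G] (le : G → G → Prop) (g r : G) : Set G :=
  {h | StrictlyDominated le (g⁻¹ * h) r}

/-- The strict left ball with centre `g` and radius the value of `r`. -/
def leftBall [Group G] (le : G → G → Prop) (g r : G) : Set G :=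
  {h | StrictlyDominated le (h * g⁻¹) r}

/-- The radii of balls are the values of nontrivial elements. -/
def IsBall [Group G] (le : G → G → Prop) (B : Set G) : Prop :=
  ∃ g r : G, r ≠ 1 ∧ (B = rightBall le g r ∨ B = leftBall le g r)

/-- Every chain (for inclusion) of right and left balls has a common point. -/
def IsSphericallyComplete [Group G] (le : G → G → Prop) : Prop :=
  ∀ S : Set (Set G), (∀ B ∈ S, IsBall le B) → IsChain (· ⊆ ·) S → (⋂₀ S).Nonempty

end Dominance

end ValuedGroup

namespace BCH

section Series

variable {L : Type*}

/-- The right-nested bracket `[a₁, [a₂, … [aₘ₋₁, aₘ] … ]]` of a list, for a bracket `br`. -/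
def nestedBracket [Zero L] (br : L → L → L) : List L → L
  | [] => 0
  | [a] => a
  | a :: b :: l => br a (nestedBracket br (b :: l))

/-- The word `x^r₁ y^s₁ ⋯ x^rₖ y^sₖ` in the letters `x` and `y`. -/
def word (x y : L) {k : ℕ} (p : Fin k → ℕ × ℕ) : List L :=
  (List.ofFn p).flatMap fun q => List.replicate q.1 x ++ List.replicate q.2 y

/-- The exponents `(r₁, s₁), …, (rₖ, sₖ)` with `rᵢ + sᵢ > 0` for all `i` and
`∑ i, (rᵢ + sᵢ) = n` (the bounds `rᵢ, sᵢ ≤ n` follow; they make the set visibly finite). -/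
def exponents (k n : ℕ) : Finset (Fin k → ℕ × ℕ) :=
  (Fintype.piFinset fun _ : Fin k => Finset.range (n + 1) ×ˢ Finset.range (n + 1)).filter
    fun p => (∀ i, 0 < (p i).1 + (p i).2) ∧ ∑ i, ((p i).1 + (p i).2) = n

/-- The homogeneous part of degree `n` of the Baker-Campbell-Hausdorff series `log (eˣ eʸ)`,
in Dynkin's form
`∑ₖ (-1)^(k-1) / k ∑ [x^r₁ y^s₁ ⋯ x^rₖ y^sₖ] / (n · r₁! s₁! ⋯ rₖ! sₖ!)`. -/
noncomputable def term (C : Type*) [Field C] [AddCommMonoid L] [SMul C L]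
    (br : L → L → L) (x y : L) (n : ℕ) : L :=
  ∑ k ∈ Finset.Icc 1 n, ∑ p ∈ exponents k n,
    ((-1 : C) ^ (k - 1) /
      ((k : C) * (n : C) * ∏ i, (((p i).1.factorial : C) * ((p i).2.factorial : C)))) •
      nestedBracket br (word x y p)

end Series

end BCH

namespace HahnField

universe u v

section Operators

variable {Γ : Type u} {C : Type v} [AddCommGroup Γ] [LinearOrder Γ] [Field C]

/-- The dominance relation `f ≼ g` of the Hahn field. Since `orderTop` is the least exponent of a
nonzero series and `⊤` for `0`, it says `f = 0`, or `f, g ≠ 0` and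
`min (supp g) ≤ min (supp f)`. -/
def Dominated (f g : HahnSeries Γ C) : Prop := g.orderTop ≤ f.orderTop

/-- The family `s` is summable, with sum `h`. -/
def HasHahnSum {I : Type*} (s : I → HahnSeries Γ C) (h : HahnSeries Γ C) : Prop :=
  ∃ F : HahnSeries.SummableFamily Γ C I, ⇑F = s ∧ F.hsum = h

/-- The map `φ` sends summable families to summable families and commutes with their sums.
(A summable family has at most `max |Γ| ℵ₀` nonzero members, so index types in the
universe of `Γ` are enough.) -/
def CommutesWithSums (φ : HahnSeries Γ C → HahnSeries Γ C) : Prop :=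
  ∀ (I : Type u) (s : I → HahnSeries Γ C) (h : HahnSeries Γ C),
    HasHahnSum s h → HasHahnSum (fun i => φ (s i)) (φ h)

/-- The map `φ` is contracting: `φ h ≺ h` for all `h ≠ 0`. -/
def IsContracting (φ : HahnSeries Γ C → HahnSeries Γ C) : Prop :=
  ∀ h, h ≠ 0 → ValuedGroup.StrictlyDominated Dominated (φ h) h

variable [IsOrderedAddMonoid Γ]

/-- The set `Cont(∂)` of all `f` for which `f ∂` is contracting. -/
def Cont (D : Derivation C (HahnSeries Γ C) (HahnSeries Γ C)) : Set (HahnSeries Γ C) :=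
  {f | IsContracting fun h => f * D h}

/-- The bracket `⟦f, g⟧ = f ∂(g) - ∂(f) g`, for which
`⟦f, g⟧ ∂ = (f ∂) ∘ (g ∂) - (g ∂) ∘ (f ∂)`. -/
noncomputable def bracket (D : Derivation C (HahnSeries Γ C) (HahnSeries Γ C)) (f g : HahnSeries Γ C) :
    HahnSeries Γ C :=
  f * D g - D f * g

/-- The series `h` is the Baker-Campbell-Hausdorff product of `f` and `g`: the family of the
homogeneous parts of the Baker-Campbell-Hausdorff series is summable, with sum `h`. -/
def IsBCHProduct (D : Derivation C (HahnSeries Γ C) (HahnSeries Γ C))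
    (f g h : HahnSeries Γ C) : Prop :=
  HasHahnSum (fun n : ℕ => BCH.term C (bracket D) f g n) h

/-- The dominance relation of the Hahn field, restricted to `Cont(∂)`. -/
def contDominated (D : Derivation C (HahnSeries Γ C) (HahnSeries Γ C)) (f g : Cont D) : Prop :=
  Dominated (f : HahnSeries Γ C) (g : HahnSeries Γ C)

end Operators

end HahnField

/-! Each `f` acts as the operator `f∂`, and the bracket of `f` and `g` acts as the commutator of
`f∂` and `g∂`. The product `f * g` should therefore be the element whose operator has exponential
`exp (f∂) ∘ exp (g∂)`, and the group law is that of composition. Three ingredients make this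
rigorous.

Algebra: Dynkin's bracket formula equals the associative expansion of `log (eˣ eʸ)`
(`BCH.assocTerm_eq_term`), and exponentiating that expansion gives back `eˣ eʸ`
(`BCH.sum_coeff_bchSeries_pow`). Both are proved for nilpotent letters with truncated series;
arbitrary letters are then placed on the subdiagonal of a matrix, where they become nilpotent
without losing the coefficient of the degree considered.

Summability: a contracting strongly linear operator strictly raises exponents. A minimal bad
sequence argument (`Set.IsNoetherianChoice.partiallyWellOrderedOn`) shows that all words in two such
operators, applied to one series, have supports inside one well-ordered set, and that each exponent
is reached by words of finitely many lengths only. So graded power series of operators can be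
evaluated, multiplied and exponentiated. Evaluating at some `e` with `∂e ≠ 0` and dividing by `∂e`
sums the homogeneous parts themselves.

Valuation: on `Cont(∂)` the bracket is strictly smaller than each nonzero argument, so `f * g - (f +
g)` is dominated by the bracket (`IsBCHProduct.le_orderTop_sub`). Hence the exponential is faithful,
`g⁻¹ * f` has the leading term of `f - g`, conjugation fixes leading terms, and balls are additive
balls, which gives near commutativity and spherical completeness. If `f` and `g` commute, a sharper
estimate forces the bracket, a Wronskian, to vanish, so that `g` is a constant multiple of `f`. -/

open Polynomial in
theorem Polynomial.X_pow_succ_dvd_of_derivative {C : Type*} [Field C] [CharZero C] {q : C[X]} {m : ℕ}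
    (h0 : q.coeff 0 = 0) (h : X ^ m ∣ derivative q) : X ^ (m + 1) ∣ q := by
  rw [X_pow_dvd_iff] at h ⊢
  intro d hd
  cases d with
  | zero => exact h0
  | succ d =>
    have := h d (by omega)
    rw [coeff_derivative] at this
    exact (mul_eq_zero.1 this).resolve_right (by exact_mod_cast d.succ_ne_zero)

/-! ### Truncated exponential and logarithm of nilpotent elements. -/

namespace BCH

section Trunc

variable (C : Type*) [Field C] {A : Type*} [Ring A] [Algebra C A]

/-- The exponential series, truncated after degree `N`. -/
noncomputable def truncExp (N : ℕ) (a : A) : A :=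
  ∑ k ∈ Finset.range (N + 1), ((k.factorial : C)⁻¹) • a ^ k

/-- The series of `log (1 + a)`, truncated after degree `N`. -/
noncomputable def truncLog (N : ℕ) (a : A) : A :=
  ∑ k ∈ Finset.Icc 1 N, ((-1 : C) ^ (k - 1) / (k : C)) • a ^ k

theorem map_truncExp {B : Type*} [Ring B] [Algebra C B] (φ : A →ₐ[C] B) (N : ℕ) (a : A) :
    φ (truncExp C N a) = truncExp C N (φ a) := by
  simp [truncExp]

theorem map_truncLog {B : Type*} [Ring B] [Algebra C B] (φ : A →ₐ[C] B) (N : ℕ) (a : A) :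
    φ (truncLog C N a) = truncLog C N (φ a) := by
  simp [truncLog]

theorem truncExp_succ (N : ℕ) (a : A) :
    truncExp C (N + 1) a = truncExp C N a + (((N + 1).factorial : C)⁻¹) • a ^ (N + 1) :=
  Finset.sum_range_succ _ _

theorem truncLog_succ (N : ℕ) (a : A) :
    truncLog C (N + 1) a =
      truncLog C N a + ((-1 : C) ^ N / ((N + 1 : ℕ) : C)) • a ^ (N + 1) := by
  rw [truncLog, Finset.sum_Icc_succ_top (by omega)]
  rfl

theorem dvd_truncLog (N : ℕ) (a : A) : ∃ v : A, Commute a v ∧ truncLog C N a = a * v := by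
  induction N with
  | zero => exact ⟨0, Commute.zero_right a, by simp [truncLog]⟩
  | succ N ih =>
    obtain ⟨v, hv, h⟩ := ih
    refine ⟨v + ((-1 : C) ^ N / ((N + 1 : ℕ) : C)) • a ^ N, ?_, ?_⟩
    · exact hv.add_right (((Commute.refl a).pow_right N).smul_right _)
    · rw [truncLog_succ, h, mul_add, mul_smul_comm, pow_succ']

theorem truncLog_pow_eq_zero {N M : ℕ} {a : A} (ha : a ^ M = 0) : truncLog C N a ^ M = 0 := by
  obtain ⟨v, hv, h⟩ := dvd_truncLog C N a
  rw [h, hv.mul_pow, ha, zero_mul]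

/-- The inner derivation `b ↦ a b - b a`. -/
noncomputable def inner (a : A) : Module.End C A :=
  LinearMap.mulLeft C a - LinearMap.mulRight C a

theorem inner_apply (a b : A) : inner C a b = a * b - b * a := rfl

open Polynomial

theorem dvd_smul_of_dvd {p q : C[X]} (c : C) (h : p ∣ q) : p ∣ c • q := by
  rw [smul_eq_C_mul]
  exact h.mul_left _

theorem dvd_truncExp_sub_one (N : ℕ) (p : C[X]) : p ∣ truncExp C N p - 1 := by
  rw [truncExp, Finset.sum_range_succ']
  simp only [pow_zero, Nat.factorial_zero, Nat.cast_one, inv_one, one_smul, add_sub_cancel_right]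
  exact Finset.dvd_sum fun k _ => dvd_smul_of_dvd C _ (dvd_pow_self p k.succ_ne_zero)

variable [CharZero C]

theorem derivative_truncExp (N : ℕ) (p : C[X]) :
    derivative (truncExp C (N + 1) p) = truncExp C N p * derivative p := by
  rw [truncExp, Finset.sum_range_succ', truncExp, derivative_add, derivative_sum, Finset.sum_mul]
  simp only [pow_zero, derivative_smul, derivative_one, smul_zero, add_zero, derivative_pow]
  refine Finset.sum_congr rfl fun k _ => ?_
  have : ((k + 1).factorial : C)⁻¹ * ((k + 1 : ℕ) : C) = (k.factorial : C)⁻¹ := by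
    have h1 : ((k + 1 : ℕ) : C) ≠ 0 := by exact_mod_cast k.succ_ne_zero
    rw [Nat.factorial_succ]; push_cast at *; field_simp
  rw [← this, smul_eq_C_mul, smul_eq_C_mul, C_mul]
  simp
  ring

theorem derivative_truncLog (N : ℕ) (p : C[X]) :
    derivative (truncLog C N p) * (1 + p) = (1 - (-p) ^ N) * derivative p := by
  induction N with
  | zero => simp [truncLog]
  | succ N ih =>
    have h1 : ((N + 1 : ℕ) : C) ≠ 0 := by exact_mod_cast N.succ_ne_zero
    rw [truncLog_succ, derivative_add, add_mul, ih, derivative_smul, derivative_pow_succ,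
      smul_eq_C_mul]
    have : Polynomial.C ((-1 : C) ^ N / ((N + 1 : ℕ) : C)) * Polynomial.C ((N : C) + 1) =
        (-1) ^ N := by
      rw [← C_mul, Nat.cast_succ, div_mul_cancel₀ _ (by exact_mod_cast h1)]
      simp
    rw [pow_succ (-p), neg_pow p N]
    linear_combination (p ^ N * derivative p * (1 + p)) * this

/-- The difference `q` has no constant term and satisfies `(1 + X) q' = q` up to truncation errors
of high order; comparing coefficients kills those of `q` one after the other. -/
theorem X_pow_dvd_truncExp_truncLog (N : ℕ) :
    (X : C[X]) ^ (N + 1) ∣ truncExp C N (truncLog C N (X : C[X])) - 1 - X := by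
  cases N with
  | zero => simp [truncExp]
  | succ m =>
    set L : C[X] := truncLog C (m + 1) (X : C[X]) with hL
    have hXL : (X : C[X]) ∣ L := by
      obtain ⟨v, -, hv⟩ := dvd_truncLog C (m + 1) (X : C[X])
      exact ⟨v, hv⟩
    set q := truncExp C (m + 1) L - 1 - X with hq
    have h0 : q.coeff 0 = 0 := by
      rw [← X_dvd_iff, hq]
      exact dvd_sub (hXL.trans (dvd_truncExp_sub_one C _ _)) dvd_rfl
    have hd : (X : C[X]) ^ (m + 1) ∣ (1 + X) * derivative q - q := by
      have e1 := derivative_truncLog C (m + 1) (X : C[X])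
      have e2 := derivative_truncExp C m L
      have e3 := truncExp_succ C m L
      have e4 : (1 + X) * derivative q - q =
          -(truncExp C m L * (-X) ^ (m + 1)) - ((((m + 1).factorial : C)⁻¹) • L ^ (m + 1)) := by
        rw [← hL, derivative_X, mul_one] at e1
        rw [hq, derivative_sub, derivative_sub, e2, e3, derivative_one, derivative_X]
        linear_combination truncExp C m L * e1
      rw [e4]
      refine dvd_sub ((Dvd.dvd.mul_left ?_ _).neg_right) (dvd_smul_of_dvd C _ (pow_dvd_pow_of_dvd hXL _))
      exact pow_dvd_pow_of_dvd (dvd_neg.2 dvd_rfl) _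
    rw [X_pow_dvd_iff] at hd ⊢
    intro d hdm
    induction d with
    | zero => exact h0
    | succ d ih =>
      have h1 := hd d (by omega)
      have h2 := ih (by omega)
      rw [coeff_sub, add_mul, one_mul, coeff_add, h2, coeff_derivative] at h1
      have h3 : (X * derivative q).coeff d = 0 := by
        cases d with
        | zero => simp
        | succ e => rw [coeff_X_mul, coeff_derivative, h2, zero_mul]
      rw [h3] at h1
      have h4 : ((d : C) + 1) ≠ 0 := by exact_mod_cast d.succ_ne_zero
      simpa [h4] using h1

/-- It suffices to bound the order of the derivative. After multiplication by `exp X`, which is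
coprime to `X`, that derivative consists of truncation errors only. -/
theorem X_pow_dvd_truncLog_truncExp (N : ℕ) :
    (X : C[X]) ^ (N + 1) ∣ truncLog C N (truncExp C N (X : C[X]) - 1) - X := by
  cases N with
  | zero => simp [truncLog]
  | succ m =>
    set y : C[X] := truncExp C (m + 1) (X : C[X]) - 1 with hy
    have hXy : (X : C[X]) ∣ y := dvd_truncExp_sub_one C _ _
    refine X_pow_succ_dvd_of_derivative ?_ ?_
    · rw [← X_dvd_iff]
      obtain ⟨v, -, hv⟩ := dvd_truncLog C (m + 1) y
      exact dvd_sub (hXy.trans ⟨v, hv⟩) dvd_rfl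
    · have e1 := derivative_truncLog C (m + 1) y
      have e2 : derivative y = (1 + y) - ((((m + 1).factorial : C)⁻¹) • (X : C[X]) ^ (m + 1)) := by
        rw [hy, derivative_sub, derivative_truncExp, derivative_one, truncExp_succ, derivative_X]
        ring
      have hcop : IsCoprime ((X : C[X]) ^ (m + 1)) (1 + y) := by
        obtain ⟨z, hz⟩ := hXy
        refine IsCoprime.pow_left ⟨-z, 1, ?_⟩
        rw [hz]; ring
      refine hcop.dvd_of_dvd_mul_right ?_
      have e3 : derivative (truncLog C (m + 1) y - X) * (1 + y) =
          -((-y) ^ (m + 1) * derivative y) - ((((m + 1).factorial : C)⁻¹) • (X : C[X]) ^ (m + 1)) := by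
        rw [derivative_sub, sub_mul, e1, derivative_X]
        linear_combination e2
      rw [e3]
      refine dvd_sub ((Dvd.dvd.mul_right ?_ _).neg_right) (dvd_smul_of_dvd C _ dvd_rfl)
      exact pow_dvd_pow_of_dvd ((dvd_neg.2 hXy)) _

theorem truncExp_truncLog {N : ℕ} {w : A} (hw : w ^ (N + 1) = 0) :
    truncExp C N (truncLog C N w) = 1 + w := by
  obtain ⟨q, hq⟩ := X_pow_dvd_truncExp_truncLog C N
  have := congrArg (aeval w) hq
  simp only [map_sub, map_mul, map_pow, aeval_X, map_one, map_truncExp, map_truncLog, hw,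
    zero_mul] at this
  rw [sub_sub, sub_eq_zero] at this
  exact this

theorem truncLog_truncExp {N : ℕ} {z : A} (hz : z ^ (N + 1) = 0) :
    truncLog C N (truncExp C N z - 1) = z := by
  obtain ⟨q, hq⟩ := X_pow_dvd_truncLog_truncExp C N
  have := congrArg (aeval z) hq
  simp only [map_sub, map_mul, map_pow, aeval_X, map_one, map_truncExp, map_truncLog, hz,
    zero_mul] at this
  exact sub_eq_zero.1 this

theorem truncExp_add {N M : ℕ} {a b : A} (hab : Commute a b) (ha : a ^ (N + 1) = 0)
    (hb : b ^ (N + 1) = 0) (hs : (a + b) ^ (M + 1) = 0) :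
    truncExp C M (a + b) = truncExp C N a * truncExp C N b := by
  -- `IsNilpotent.exp` needs rational scalars; restricting them from `C` makes it agree with the
  -- truncation.
  let _ : Module ℚ A := Module.compHom A (algebraMap ℚ C)
  have key : ∀ (K : ℕ) (c : A), c ^ (K + 1) = 0 → truncExp C K c = IsNilpotent.exp c := by
    intro K c hc
    rw [IsNilpotent.exp_eq_sum hc, truncExp]
    refine Finset.sum_congr rfl fun k _ => ?_
    change _ = (algebraMap ℚ C ((k.factorial : ℚ)⁻¹)) • c ^ k
    simp
  rw [key _ _ ha, key _ _ hb, key _ _ hs]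
  exact IsNilpotent.exp_add_of_commute hab ⟨_, ha⟩ ⟨_, hb⟩

theorem truncExp_mul_truncExp_neg {N : ℕ} {a : A} (ha : a ^ (N + 1) = 0) :
    truncExp C N a * truncExp C N (-a) = 1 := by
  rw [← truncExp_add C (M := 0) (Commute.neg_right (Commute.refl a)) ha
    (by rw [neg_pow, ha, mul_zero]) (by simp)]
  simp [truncExp]

end Trunc

end BCH

/-! ### Noncommutative powers, words and exponent tuples. -/

theorem Finset.sum_pow_eq_sum_piFinset_list {A ι : Type*} [Semiring A] (T : Finset ι)
    (f : ι → A) (k : ℕ) :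
    (∑ q ∈ T, f q) ^ k =
      ∑ p ∈ Fintype.piFinset fun _ : Fin k => T, (List.ofFn fun i => f (p i)).prod := by
  induction k with
  | zero => simp
  | succ k ih =>
    rw [pow_succ', ih, Finset.sum_mul_sum, ← Finset.sum_product']
    refine Finset.sum_nbij' (fun x => Fin.cons x.1 x.2) (fun p => (p 0, Fin.tail p)) ?_ ?_ ?_ ?_ ?_
    · rintro ⟨a, p⟩ h
      simp only [Finset.mem_product, Fintype.mem_piFinset] at h ⊢
      exact fun i => Fin.cases h.1 h.2 i
    · intro p h
      simp only [Finset.mem_product, Fintype.mem_piFinset] at h ⊢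
      exact ⟨h 0, fun i => h i.succ⟩
    · rintro ⟨a, p⟩ -
      simp
    · intro p _
      simp
    · rintro ⟨a, p⟩ -
      simp [List.ofFn_succ]

namespace BCH

section Words

variable {L M : Type*}

theorem word_map (φ : L → M) (x y : L) {k : ℕ} (p : Fin k → ℕ × ℕ) :
    word (φ x) (φ y) p = (word x y p).map φ := by
  simp [word, List.map_flatMap]

theorem mem_word {x y a : L} {k : ℕ} {p : Fin k → ℕ × ℕ} (h : a ∈ word x y p) :
    a = x ∨ a = y := by
  simp only [word, List.mem_flatMap, List.mem_append, List.mem_replicate] at h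
  tauto

theorem length_word (x y : L) {k : ℕ} (p : Fin k → ℕ × ℕ) :
    (word x y p).length = ∑ i, ((p i).1 + (p i).2) := by
  rw [word, List.length_flatMap, List.map_ofFn, List.sum_ofFn]
  simp

theorem mem_exponents {k n : ℕ} {p : Fin k → ℕ × ℕ} :
    p ∈ exponents k n ↔ (∀ i, 0 < (p i).1 + (p i).2) ∧ ∑ i, ((p i).1 + (p i).2) = n := by
  simp only [exponents, Finset.mem_filter, Fintype.mem_piFinset, Finset.mem_product,
    Finset.mem_range, and_iff_right_iff_imp]
  rintro ⟨-, h⟩ i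
  have := Finset.single_le_sum (f := fun i => (p i).1 + (p i).2) (fun _ _ => Nat.zero_le _)
    (Finset.mem_univ i)
  omega

theorem length_word_of_mem_exponents (x y : L) {k n : ℕ} {p : Fin k → ℕ × ℕ}
    (hp : p ∈ exponents k n) : (word x y p).length = n := by
  rw [length_word, (mem_exponents.1 hp).2]

theorem le_of_mem_exponents {k n : ℕ} {p : Fin k → ℕ × ℕ} (hp : p ∈ exponents k n) : k ≤ n := by
  rw [mem_exponents] at hp
  rw [← hp.2]
  calc k = ∑ _i : Fin k, 1 := by simp
    _ ≤ _ := Finset.sum_le_sum fun i _ => hp.1 i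

theorem exponents_eq_empty {k n : ℕ} (h : n < k) : exponents k n = ∅ :=
  Finset.eq_empty_of_forall_notMem fun _ hp => absurd (le_of_mem_exponents hp) (by omega)

theorem prod_word {A : Type*} [Monoid A] (x y : A) {k : ℕ} (p : Fin k → ℕ × ℕ) :
    (word x y p).prod = (List.ofFn fun i => x ^ (p i).1 * y ^ (p i).2).prod := by
  induction k with
  | zero => simp [word]
  | succ k ih =>
    have : word x y p = (List.replicate (p 0).1 x ++ List.replicate (p 0).2 y) ++
        word x y (fun i => p i.succ) := by
      simp [word, List.ofFn_succ]
    rw [this, List.prod_append, ih, List.ofFn_succ]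
    simp

theorem nestedBracket_congr_map [Zero L] [Zero M] {b : L → L → L} {b' : M → M → M} {φ : L → M}
    (h0 : φ 0 = 0) (h : ∀ x y, φ (b x y) = b' (φ x) (φ y)) (l : List L) :
    nestedBracket b' (l.map φ) = φ (nestedBracket b l) := by
  induction l with
  | nil => simp [nestedBracket, h0]
  | cons a l ih =>
    cases l with
    | nil => rfl
    | cons c l => simpa [nestedBracket, h] using congrArg (b' (φ a)) ih

theorem map_term {C : Type*} [Field C] [AddCommGroup L] [Module C L] [AddCommGroup M] [Module C M]
    {b : L → L → L} {b' : M → M → M} (φ : L →ₗ[C] M) (h : ∀ x y, φ (b x y) = b' (φ x) (φ y))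
    (x y : L) (n : ℕ) : φ (term C b x y n) = term C b' (φ x) (φ y) n := by
  simp only [term, map_sum, map_smul]
  refine Finset.sum_congr rfl fun k _ => Finset.sum_congr rfl fun p _ => ?_
  rw [word_map, nestedBracket_congr_map (map_zero φ) h]

end Words

/-! ### The Baker-Campbell-Hausdorff series for nilpotent letters. -/

section Assoc

variable (C : Type*) [Field C] {A : Type*} [Ring A] [Algebra C A]

/-- The homogeneous part of degree `n` of `log (eˣ eʸ)`, as a noncommutative polynomial. -/
noncomputable def assocTerm (x y : A) (n : ℕ) : A :=
  ∑ k ∈ Finset.Icc 1 n, ∑ p ∈ exponents k n,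
    ((-1 : C) ^ (k - 1) /
      ((k : C) * ∏ i, (((p i).1.factorial : C) * ((p i).2.factorial : C)))) • (word x y p).prod

/-- All products of more than `N` letters `x` and `y` vanish. -/
def WordsVanish (x y : A) (N : ℕ) : Prop :=
  ∀ l : List A, (∀ a ∈ l, a = x ∨ a = y) → N < l.length → l.prod = 0

variable {C}

theorem WordsVanish.left {x y : A} {N : ℕ} (h : WordsVanish x y N) : x ^ (N + 1) = 0 := by
  simpa using h (List.replicate (N + 1) x)
    (fun a ha => Or.inl (List.eq_of_mem_replicate ha)) (by simp)

theorem WordsVanish.right {x y : A} {N : ℕ} (h : WordsVanish x y N) : y ^ (N + 1) = 0 := by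
  simpa using h (List.replicate (N + 1) y)
    (fun a ha => Or.inr (List.eq_of_mem_replicate ha)) (by simp)

theorem truncExp_mul_truncExp_sub_one (x y : A) (N : ℕ) :
    truncExp C N x * truncExp C N y - 1 =
      ∑ q ∈ (Finset.range (N + 1) ×ˢ Finset.range (N + 1)).erase (0, 0),
        ((q.1.factorial : C) * (q.2.factorial : C))⁻¹ • (x ^ q.1 * y ^ q.2) := by
  have h0 : (0, 0) ∈ Finset.range (N + 1) ×ˢ Finset.range (N + 1) := by simp
  have h1 : truncExp C N x * truncExp C N y = ∑ q ∈ Finset.range (N + 1) ×ˢ Finset.range (N + 1),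
      ((q.1.factorial : C) * (q.2.factorial : C))⁻¹ • (x ^ q.1 * y ^ q.2) := by
    rw [truncExp, truncExp, Finset.sum_mul_sum, ← Finset.sum_product']
    refine Finset.sum_congr rfl fun q _ => ?_
    rw [smul_mul_smul_comm, mul_inv]
  rw [h1, ← Finset.add_sum_erase _ _ h0]
  simp

theorem prod_ofFn_smul {k : ℕ} (c : Fin k → C) (f : Fin k → A) :
    (List.ofFn fun i => c i • f i).prod = (∏ i, c i) • (List.ofFn f).prod := by
  induction k with
  | zero => simp
  | succ k ih =>
    rw [List.ofFn_succ, List.ofFn_succ, List.prod_cons, List.prod_cons, ih, Fin.prod_univ_succ,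
      smul_mul_smul_comm]

theorem truncExp_mul_truncExp_sub_one_pow {x y : A} {N : ℕ} (h : WordsVanish x y N) (k : ℕ) :
    (truncExp C N x * truncExp C N y - 1) ^ k =
      ∑ n ∈ Finset.range (N + 1), ∑ p ∈ exponents k n,
        (∏ i, (((p i).1.factorial : C) * ((p i).2.factorial : C)))⁻¹ • (word x y p).prod := by
  rw [truncExp_mul_truncExp_sub_one, Finset.sum_pow_eq_sum_piFinset_list]
  set T := (Finset.range (N + 1) ×ˢ Finset.range (N + 1)).erase (0, 0) with hT
  have e : ∀ p : Fin k → ℕ × ℕ, (List.ofFn fun i => (((p i).1.factorial : C) *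
      ((p i).2.factorial : C))⁻¹ • (x ^ (p i).1 * y ^ (p i).2)).prod =
      (∏ i, (((p i).1.factorial : C) * ((p i).2.factorial : C)))⁻¹ • (word x y p).prod := by
    intro p
    rw [prod_ofFn_smul (fun i => (((p i).1.factorial : C) * ((p i).2.factorial : C))⁻¹),
      prod_word, Finset.prod_inv_distrib]
  simp only [e]
  have hfib : ∀ n ∈ Finset.range (N + 1), exponents k n =
      (Fintype.piFinset fun _ : Fin k => T).filter fun p => ∑ i, ((p i).1 + (p i).2) = n := by
    intro n hn
    ext p
    rw [mem_exponents, Finset.mem_filter, Fintype.mem_piFinset]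
    refine and_congr_left fun hs => forall_congr' fun i => ?_
    have := Finset.single_le_sum (f := fun i => (p i).1 + (p i).2) (fun _ _ => Nat.zero_le _)
      (Finset.mem_univ i)
    simp only [Finset.mem_range] at this hn
    simp only [hT, Finset.mem_erase, Finset.mem_product, Finset.mem_range, ne_eq, Prod.ext_iff]
    omega
  have hrhs : ∀ F : (Fin k → ℕ × ℕ) → A, (∑ n ∈ Finset.range (N + 1), ∑ p ∈ exponents k n, F p) =
      ∑ p ∈ (Fintype.piFinset fun _ : Fin k => T).filter
        (fun p => ∑ i, ((p i).1 + (p i).2) ∈ Finset.range (N + 1)), F p := by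
    intro F
    rw [← Finset.sum_fiberwise_eq_sum_filter]
    exact Finset.sum_congr rfl fun n hn => by rw [hfib n hn]
  rw [hrhs]
  symm
  -- The tuples of total degree above `N` contribute nothing, because their words vanish.
  refine Finset.sum_subset (Finset.filter_subset _ _) fun p hp hpn => ?_
  have hlen : N < (word x y p).length := by
    rw [length_word]
    by_contra hcon
    exact hpn (Finset.mem_filter.2 ⟨hp, Finset.mem_range.2 (by omega)⟩)
  rw [h _ (fun a ha => mem_word ha) hlen, smul_zero]

/-- Interchange the sums over the power `k` and the degree `n`. Each of the `k` factors has positive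
degree, so only `k ≤ n` matters. -/
theorem truncLog_eq_sum_assocTerm {x y : A} {N : ℕ} (h : WordsVanish x y N) :
    truncLog C N (truncExp C N x * truncExp C N y - 1) =
      ∑ n ∈ Finset.range (N + 1), assocTerm C x y n := by
  simp only [truncLog, truncExp_mul_truncExp_sub_one_pow h, Finset.smul_sum, smul_smul]
  rw [Finset.sum_comm]
  refine Finset.sum_congr rfl fun n hn => ?_
  rw [assocTerm]
  symm
  refine Finset.sum_subset_zero_on_sdiff ?_ ?_ ?_
  · exact Finset.Icc_subset_Icc_right (by simpa [Nat.lt_succ_iff] using hn)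
  · intro k hk
    rw [exponents_eq_empty, Finset.sum_empty]
    simp only [Finset.mem_sdiff, Finset.mem_Icc] at hk
    omega
  · intro k _
    refine Finset.sum_congr rfl fun p _ => ?_
    rw [div_mul_eq_div_div, div_eq_mul_inv (_ / _)]

theorem WordsVanish.pow_eq_zero {x y : A} {N : ℕ} (h : WordsVanish x y N) :
    (truncExp C N x * truncExp C N y - 1) ^ (N + 1) = 0 := by
  rw [truncExp_mul_truncExp_sub_one_pow h]
  refine Finset.sum_eq_zero fun n hn => ?_
  rw [exponents_eq_empty (by simpa using hn), Finset.sum_empty]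

theorem prod_map_inner_mem_span {x y : A} (l : List A) (hl : ∀ a ∈ l, a = x ∨ a = y) (b : A) :
    (l.map (inner C)).prod b ∈ Submodule.span C {c : A | ∃ u v : List A,
      (∀ a ∈ u, a = x ∨ a = y) ∧ (∀ a ∈ v, a = x ∨ a = y) ∧ u.length + v.length = l.length ∧
      c = u.prod * b * v.prod} := by
  induction l with
  | nil => exact Submodule.subset_span ⟨[], [], by simp, by simp, rfl, by simp⟩
  | cons a l ih =>
    have ih := ih fun c hc => hl c (List.mem_cons_of_mem _ hc)
    have ha := hl a List.mem_cons_self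
    rw [List.map_cons, List.prod_cons, Module.End.mul_apply]
    refine Submodule.span_induction (p := fun c _ => inner C a c ∈ _) ?_ ?_ ?_ ?_ ih
    · rintro c ⟨u, v, hu, hv, hlen, rfl⟩
      rw [inner_apply]
      refine Submodule.sub_mem _ (Submodule.subset_span ⟨a :: u, v, ?_, hv, ?_, ?_⟩)
        (Submodule.subset_span ⟨u, v ++ [a], hu, ?_, ?_, ?_⟩)
      · simpa using ⟨ha, hu⟩
      · simp; omega
      · simp [mul_assoc]
      · intro c hc
        rcases List.mem_append.1 hc with hc | hc
        · exact hv c hc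
        · rw [List.mem_singleton.1 hc]; exact ha
      · simp; omega
      · simp [mul_assoc]
    · simp
    · intro c d _ _ hc hd
      rw [map_add]; exact Submodule.add_mem _ hc hd
    · intro r c _ hc
      rw [map_smul]; exact Submodule.smul_mem _ _ hc

/-- An iterated commutator distributes its letters to the left and right of its argument. Of more
than `2 * N` letters, more than `N` end up on one side. -/
theorem WordsVanish.inner {x y : A} {N : ℕ} (h : WordsVanish x y N) :
    WordsVanish (inner C x) (inner C y) (2 * N) := by
  intro l hl hlen
  obtain ⟨m, rfl, hm⟩ : ∃ m : List A, m.map (BCH.inner C) = l ∧ ∀ a ∈ m, a = x ∨ a = y := by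
    clear hlen
    induction l with
    | nil => exact ⟨[], rfl, by simp⟩
    | cons c l ih =>
      obtain ⟨m, rfl, hm⟩ := ih fun d hd => hl d (List.mem_cons_of_mem _ hd)
      rcases hl c List.mem_cons_self with rfl | rfl
      · exact ⟨x :: m, rfl, by simpa using hm⟩
      · exact ⟨y :: m, rfl, by simpa using hm⟩
  ext b
  have hspan := prod_map_inner_mem_span (C := C) m hm b
  rw [List.length_map] at hlen
  rw [Submodule.span_eq_bot.2, Submodule.mem_bot] at hspan
  · exact hspan
  · rintro c ⟨u, v, hu, hv, huv, rfl⟩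
    rcases lt_or_ge N u.length with h1 | h1
    · rw [h u hu h1, zero_mul, zero_mul]
    · rw [h v hv (by omega), mul_zero]

theorem inner_sum_apply {ι : Type*} (s : Finset ι) (a : ι → A) (b : A) :
    inner C (∑ i ∈ s, a i) b = ∑ i ∈ s, inner C (a i) b := by
  simp only [inner_apply, Finset.sum_mul, Finset.mul_sum, Finset.sum_sub_distrib]

theorem inner_pow_eq_zero {N : ℕ} {z : A} (hz : z ^ (N + 1) = 0) :
    inner C z ^ (2 * N + 1) = 0 := by
  have hw : WordsVanish z z N := by
    intro l hl hlen
    rw [List.eq_replicate_iff.2 ⟨rfl, fun b hb => (hl b hb).elim id id⟩, List.prod_replicate]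
    exact pow_eq_zero_of_le hlen hz
  exact (hw.inner (C := C)).left

/-- Only the innermost letter meets `D`, and it turns `D` into minus itself; the remaining letters
then form the nested commutator. -/
theorem prod_map_inner_apply {D : A} (l : List A) (hl : l ≠ [])
    (hD : ∀ a ∈ l, inner C a D = -a) :
    (l.map (inner C)).prod D = -nestedBracket (fun a b => a * b - b * a) l := by
  induction l with
  | nil => exact absurd rfl hl
  | cons a l ih =>
    cases l with
    | nil => simpa [nestedBracket] using hD a List.mem_cons_self
    | cons c l =>
      rw [List.map_cons, List.prod_cons, Module.End.mul_apply,
        ih (by simp) fun d hd => hD d (List.mem_cons_of_mem _ hd), map_neg, inner_apply]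
      rfl

variable [CharZero C]

/-- The inner derivation of `z` is the sum of left multiplication by `z` and right multiplication by
`-z`, which commute, so its exponential is conjugation by `exp z`. -/
theorem truncExp_inner {N : ℕ} {z : A} (hz : z ^ (N + 1) = 0) (b : A) :
    truncExp C (2 * N) (inner C z) b = truncExp C N z * b * truncExp C N (-z) := by
  have e : inner C z = LinearMap.mulLeft C z + LinearMap.mulRight C (-z) := by
    ext b; simp [inner_apply, sub_eq_add_neg]
  have h1 : (LinearMap.mulLeft C z) ^ (N + 1) = 0 := by
    rw [LinearMap.pow_mulLeft, hz, LinearMap.mulLeft_zero_eq_zero]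
  have h2 : (LinearMap.mulRight C (-z)) ^ (N + 1) = 0 := by
    rw [LinearMap.pow_mulRight, neg_pow, hz, mul_zero, LinearMap.mulRight_zero_eq_zero]
  have h3 := inner_pow_eq_zero (C := C) hz
  rw [e] at h3 ⊢
  rw [truncExp_add C (LinearMap.commute_mulLeft_right z (-z)) h1 h2 h3]
  have hl : ∀ c, truncExp C N (LinearMap.mulLeft C z) c = truncExp C N z * c := fun c => by
    simp [truncExp, LinearMap.pow_mulLeft, Finset.sum_mul]
  have hr : ∀ c, truncExp C N (LinearMap.mulRight C (-z)) c = c * truncExp C N (-z) := fun c => by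
    simp [truncExp, LinearMap.pow_mulRight, Finset.mul_sum]
  rw [Module.End.mul_apply, hl, hr, mul_assoc]

/-- `ad (log (eˣ eʸ)) = log (e^(ad x) e^(ad y))`, for nilpotent letters. -/
theorem inner_sum_assocTerm {x y : A} {N : ℕ} (h : WordsVanish x y N) :
    inner C (∑ n ∈ Finset.range (N + 1), assocTerm C x y n) =
      ∑ n ∈ Finset.range (2 * N + 1), assocTerm C (inner C x) (inner C y) n := by
  rw [← truncLog_eq_sum_assocTerm h, ← truncLog_eq_sum_assocTerm h.inner]
  set w := truncExp C N x * truncExp C N y - 1 with hw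
  set z := truncLog C N w with hz
  have hwN : w ^ (N + 1) = 0 := h.pow_eq_zero
  have hzN : z ^ (N + 1) = 0 := truncLog_pow_eq_zero C hwN
  have hez : truncExp C N z = truncExp C N x * truncExp C N y := by
    rw [hz, truncExp_truncLog C hwN, hw]; abel
  have hinv : truncExp C N (-z) = truncExp C N (-y) * truncExp C N (-x) := by
    have h1 : truncExp C N (-z) * (truncExp C N x * truncExp C N y) = 1 := by
      rw [← hez]
      simpa using truncExp_mul_truncExp_neg C (a := -z) (by rw [neg_pow, hzN, mul_zero])
    have h2 : truncExp C N x * truncExp C N y * (truncExp C N (-y) * truncExp C N (-x)) = 1 := by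
      rw [mul_assoc, ← mul_assoc (truncExp C N y), truncExp_mul_truncExp_neg C h.right, one_mul,
        truncExp_mul_truncExp_neg C h.left]
    exact left_inv_eq_right_inv h1 h2
  -- Both sides are conjugation by `eˣ eʸ = eᶻ`. The logarithm then recovers the inner derivation of
  -- `z`, which is nilpotent.
  have : truncExp C (2 * N) (inner C x) * truncExp C (2 * N) (inner C y) =
      truncExp C (2 * N) (inner C z) := by
    ext b
    rw [Module.End.mul_apply, truncExp_inner h.left, truncExp_inner h.right, truncExp_inner hzN,
      hez, hinv]
    simp only [mul_assoc]
  rw [this, truncLog_truncExp C (inner_pow_eq_zero hzN)]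

theorem truncExp_sum_assocTerm {x y : A} {N : ℕ} (h : WordsVanish x y N) :
    truncExp C N (∑ n ∈ Finset.range (N + 1), assocTerm C x y n) =
      truncExp C N x * truncExp C N y := by
  rw [← truncLog_eq_sum_assocTerm h, truncExp_truncLog C h.pow_eq_zero]
  abel

theorem smul_term {L : Type*} [AddCommGroup L] [Module C L] (b : L → L → L) (x y : L) (n : ℕ) :
    (n : C) • term C b x y n = ∑ k ∈ Finset.Icc 1 n, ∑ p ∈ exponents k n,
      ((-1 : C) ^ (k - 1) /
      ((k : C) * ∏ i, (((p i).1.factorial : C) * ((p i).2.factorial : C)))) •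
        nestedBracket b (word x y p) := by
  simp only [term, Finset.smul_sum, smul_smul]
  refine Finset.sum_congr rfl fun k hk => Finset.sum_congr rfl fun p _ => ?_
  have : (n : C) ≠ 0 := by
    rw [Finset.mem_Icc] at hk
    exact_mod_cast (by omega : n ≠ 0)
  congr 1
  rw [mul_comm (k : C), mul_assoc, mul_div_assoc', mul_div_mul_left _ _ this]

/-- The Euler element `D` acts on `log (eˣ eʸ)` through right-nested brackets. -/
theorem inner_sum_assocTerm_apply {x y D : A} {N : ℕ} (h : WordsVanish x y N)
    (hx : inner C x D = -x) (hy : inner C y D = -y) :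
    inner C (∑ n ∈ Finset.range (N + 1), assocTerm C x y n) D =
      -∑ n ∈ Finset.range (2 * N + 1), (n : C) • term C (fun a b : A => a * b - b * a) x y n := by
  rw [inner_sum_assocTerm h, LinearMap.sum_apply, ← Finset.sum_neg_distrib]
  refine Finset.sum_congr rfl fun n _ => ?_
  rw [smul_term, assocTerm]
  simp only [LinearMap.sum_apply, LinearMap.smul_apply, ← Finset.sum_neg_distrib, ← smul_neg]
  refine Finset.sum_congr rfl fun k hk => Finset.sum_congr rfl fun p hp => ?_
  congr 1
  rw [word_map, prod_map_inner_apply]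
  · intro h0
    have := length_word_of_mem_exponents x y hp
    rw [h0] at this
    rw [Finset.mem_Icc] at hk
    simp at this
    omega
  · intro a ha
    rcases mem_word ha with rfl | rfl
    · exact hx
    · exact hy

end Assoc

end BCH

/-! ### Passage to arbitrary letters through Toeplitz matrices; Dynkin's formula. -/

namespace BCH

section Toeplitz

open PowerSeries

variable (C : Type*) [Field C] {R : Type*} [Ring R] [Algebra C R]

/-- The lower triangular Toeplitz matrix of size `N + 1` given by a power series. -/
noncomputable def toeplitz (N : ℕ) : R⟦X⟧ →ₐ[C] Matrix (Fin (N + 1)) (Fin (N + 1)) R :=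
  AlgHom.ofLinearMap
    { toFun P := Matrix.of fun i j => if j ≤ i then coeff ((i : ℕ) - j) P else 0
      map_add' P Q := by
        ext i j
        simp only [Matrix.of_apply, Matrix.add_apply, map_add]
        split_ifs <;> simp
      map_smul' c P := by
        ext i j
        simp only [Matrix.of_apply, Matrix.smul_apply, RingHom.id_apply]
        split_ifs
        · rfl
        · simp }
    (by
      ext i j
      simp only [LinearMap.coe_mk, AddHom.coe_mk, Matrix.of_apply, Matrix.one_apply, coeff_one,
        Fin.le_def, Fin.ext_iff]
      split_ifs <;> first | rfl | omega)
    (by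
      intro P Q
      ext i j
      simp only [LinearMap.coe_mk, AddHom.coe_mk, Matrix.of_apply, Matrix.mul_apply]
      split_ifs with hij
      · rw [coeff_mul]
        symm
        rw [← Finset.sum_subset (Finset.subset_univ (Finset.Icc j i))]
        -- The minimum with `N - j` only keeps the index in range for arbitrary pairs; it has no
        -- effect on the antidiagonal.
        · refine Finset.sum_nbij' (fun m => ((i : ℕ) - m, (m : ℕ) - j))
            (fun q => ⟨j + q.2 ⊓ (N - j), by omega⟩) ?_ ?_ ?_ ?_ ?_
          · intro m hm
            simp only [Finset.mem_Icc, Fin.le_def] at hm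
            simp only [Finset.HasAntidiagonal.mem_antidiagonal]
            omega
          · intro q hq
            simp only [Finset.HasAntidiagonal.mem_antidiagonal] at hq
            simp only [Finset.mem_Icc, Fin.le_def]
            omega
          · intro m hm
            simp only [Finset.mem_Icc, Fin.le_def] at hm
            ext
            change (j : ℕ) + ((m : ℕ) - j) ⊓ (N - j) = m
            omega
          · intro q hq
            simp only [Finset.HasAntidiagonal.mem_antidiagonal] at hq
            have := Fin.le_def.1 hij
            have := i.is_lt
            refine Prod.ext ?_ ?_
            · change (i : ℕ) - (j + q.2 ⊓ (N - j)) = q.1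
              omega
            · change (j + q.2 ⊓ (N - j) : ℕ) - j = q.2
              omega
          · intro m hm
            rw [Finset.mem_Icc] at hm
            rw [if_pos hm.1, if_pos hm.2]
        · intro m _ hm
          rw [Finset.mem_Icc, not_and_or] at hm
          rcases hm with hm | hm
          · rw [if_neg hm, mul_zero]
          · rw [if_neg hm, zero_mul]
      · symm
        refine Finset.sum_eq_zero fun m _ => ?_
        by_cases h1 : j ≤ m
        · rw [if_neg fun h2 => hij (h1.trans h2), zero_mul]
        · rw [if_neg h1, mul_zero])

theorem toeplitz_apply (N : ℕ) (P : R⟦X⟧) (i j : Fin (N + 1)) :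
    toeplitz C N P i j = if j ≤ i then coeff ((i : ℕ) - j) P else 0 := rfl

theorem toeplitz_last_zero (N : ℕ) (P : R⟦X⟧) :
    toeplitz C N P (Fin.last N) 0 = coeff N P := by
  simp [toeplitz_apply]

/-- The matrix with constant `k`-th subdiagonal `a`. -/
noncomputable def subdiagonal (N k : ℕ) (a : R) : Matrix (Fin (N + 1)) (Fin (N + 1)) R :=
  toeplitz C N (monomial k a)

theorem subdiagonal_mul (N k l : ℕ) (a b : R) :
    subdiagonal C N k a * subdiagonal C N l b = subdiagonal C N (k + l) (a * b) := by
  rw [subdiagonal, subdiagonal, ← map_mul, monomial_mul_monomial]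
  rfl

theorem subdiagonal_eq_zero {N k : ℕ} (h : N < k) (a : R) : subdiagonal C N k a = 0 := by
  ext i j
  have : (i : ℕ) - j ≠ k := by omega
  simp [subdiagonal, toeplitz_apply, coeff_monomial, this]

theorem subdiagonal_smul (N k : ℕ) (c : C) (a : R) :
    subdiagonal C N k (c • a) = c • subdiagonal C N k a := by
  have : monomial k (c • a) = c • monomial k a := by
    ext n
    rw [coeff_monomial, coeff_smul, coeff_monomial]
    split_ifs <;> simp
  rw [subdiagonal, this, map_smul]
  rfl

theorem subdiagonal_sum {ι : Type*} (N k : ℕ) (s : Finset ι) (a : ι → R) :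
    subdiagonal C N k (∑ i ∈ s, a i) = ∑ i ∈ s, subdiagonal C N k (a i) := by
  simp [subdiagonal]

theorem subdiagonal_sub (N k : ℕ) (a b : R) :
    subdiagonal C N k (a - b) = subdiagonal C N k a - subdiagonal C N k b := by
  simp [subdiagonal]

theorem prod_map_subdiagonal (N : ℕ) (l : List R) :
    (l.map (subdiagonal C N 1)).prod = subdiagonal C N l.length l.prod := by
  induction l with
  | nil => simp [subdiagonal, monomial_zero_eq_C_apply]
  | cons a l ih =>
    rw [List.map_cons, List.prod_cons, ih, subdiagonal_mul, List.prod_cons, List.length_cons,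
      add_comm 1 l.length]

theorem wordsVanish_subdiagonal (N : ℕ) (x y : R) :
    WordsVanish (subdiagonal C N 1 x) (subdiagonal C N 1 y) N := by
  intro l hl hlen
  have : ∃ c, l.prod = subdiagonal C N l.length c := by
    clear hlen
    induction l with
    | nil => exact ⟨1, by simp [subdiagonal, monomial_zero_eq_C_apply]⟩
    | cons a l ih =>
      obtain ⟨c, hc⟩ := ih fun b hb => hl b (List.mem_cons_of_mem _ hb)
      rw [List.prod_cons, hc, List.length_cons, add_comm l.length 1]
      rcases hl a List.mem_cons_self with rfl | rfl
      · exact ⟨_, subdiagonal_mul C _ _ _ _ _⟩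
      · exact ⟨_, subdiagonal_mul C _ _ _ _ _⟩
  obtain ⟨c, hc⟩ := this
  rw [hc, subdiagonal_eq_zero C hlen]

theorem assocTerm_subdiagonal (N : ℕ) (x y : R) (n : ℕ) :
    assocTerm C (subdiagonal C N 1 x) (subdiagonal C N 1 y) n =
      subdiagonal C N n (assocTerm C x y n) := by
  simp only [assocTerm, subdiagonal_sum, subdiagonal_smul]
  refine Finset.sum_congr rfl fun k _ => Finset.sum_congr rfl fun p hp => ?_
  rw [word_map, prod_map_subdiagonal, length_word_of_mem_exponents x y hp]

theorem nestedBracket_subdiagonal (N : ℕ) (l : List R) :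
    nestedBracket (fun a b => a * b - b * a) (l.map (subdiagonal C N 1)) =
      subdiagonal C N l.length (nestedBracket (fun a b => a * b - b * a) l) := by
  induction l with
  | nil => simp [nestedBracket, subdiagonal]
  | cons a l ih =>
    cases l with
    | nil => rfl
    | cons c l =>
      simp only [List.map_cons, nestedBracket, List.length_cons] at ih ⊢
      rw [ih, subdiagonal_mul, subdiagonal_mul, add_comm 1, ← subdiagonal_sub]

theorem term_subdiagonal (N : ℕ) (x y : R) (n : ℕ) :
    term C (fun a b => a * b - b * a) (subdiagonal C N 1 x) (subdiagonal C N 1 y) n =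
      subdiagonal C N n (term C (fun a b => a * b - b * a) x y n) := by
  simp only [term, subdiagonal_sum, subdiagonal_smul]
  refine Finset.sum_congr rfl fun k _ => Finset.sum_congr rfl fun p hp => ?_
  rw [word_map, nestedBracket_subdiagonal, length_word_of_mem_exponents x y hp]

/-- The diagonal matrix with entries `0, …, N` is the Euler element: a commutator with it multiplies
the entry at `(i, j)` by `j - i`, which is `-n` on the `n`-th subdiagonal. -/
theorem inner_subdiagonal (N n : ℕ) (a : R) :
    inner C (subdiagonal C N n a) (Matrix.diagonal fun i : Fin (N + 1) => ((i : ℕ) : R)) =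
      -((n : C) • subdiagonal C N n a) := by
  ext i j
  rw [inner_apply, Matrix.sub_apply, Matrix.mul_diagonal, Matrix.diagonal_mul, Matrix.neg_apply,
    Matrix.smul_apply, subdiagonal, toeplitz_apply, coeff_monomial]
  by_cases hij : j ≤ i
  · rw [if_pos hij]
    split_ifs with h
    · have : (i : ℕ) = n + j := by have := Fin.le_def.1 hij; omega
      rw [this, Algebra.smul_def, map_natCast, Nat.cast_add, add_mul, (Nat.cast_commute (j : ℕ) a).eq]
      abel
    · simp
  · simp [if_neg hij]

/-- The exponential series `∑ (tx)ⁿ / n!`. -/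
noncomputable def expSeries (x : R) : R⟦X⟧ := mk fun n => ((n.factorial : C)⁻¹) • x ^ n

/-- The Baker-Campbell-Hausdorff series of `x` and `y`, graded by a central variable. -/
noncomputable def bchSeries (x y : R) : R⟦X⟧ := mk (assocTerm C x y)

theorem toeplitz_expSeries (N : ℕ) (x : R) :
    toeplitz C N (expSeries C x) = truncExp C N (subdiagonal C N 1 x) := by
  have : ∀ k, subdiagonal C N 1 x ^ k = subdiagonal C N k (x ^ k) := fun k => by
    simpa using prod_map_subdiagonal C N (List.replicate k x)
  simp only [truncExp, this]
  ext i j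
  simp only [Matrix.sum_apply, Matrix.smul_apply, subdiagonal, toeplitz_apply, coeff_monomial]
  by_cases hij : j ≤ i
  · simp only [if_pos hij, smul_ite, smul_zero, Finset.sum_ite_eq, Finset.mem_range]
    rw [if_pos (by omega), expSeries, coeff_mk]
  · simp [if_neg hij]

theorem toeplitz_bchSeries (N : ℕ) (x y : R) :
    toeplitz C N (bchSeries C x y) =
      ∑ n ∈ Finset.range (N + 1), subdiagonal C N n (assocTerm C x y n) := by
  ext i j
  simp only [Matrix.sum_apply, subdiagonal, toeplitz_apply, coeff_monomial]
  by_cases hij : j ≤ i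
  · simp only [if_pos hij, Finset.sum_ite_eq, Finset.mem_range]
    rw [if_pos (by omega), bchSeries, coeff_mk]
  · simp [if_neg hij]

theorem coeff_bchSeries_pow_eq_zero (x y : R) {n m : ℕ} (h : n < m) :
    coeff n (bchSeries C x y ^ m) = 0 := by
  induction m generalizing n with
  | zero => omega
  | succ m ih =>
    rw [pow_succ, coeff_mul]
    refine Finset.sum_eq_zero fun q hq => ?_
    rw [Finset.HasAntidiagonal.mem_antidiagonal] at hq
    by_cases h1 : q.1 < m
    · rw [ih h1, zero_mul]
    · have : q.2 = 0 := by omega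
      rw [this, bchSeries, coeff_mk]
      simp [assocTerm]

variable [CharZero C]

/-- **Dynkin's formula**: the homogeneous parts of `log (eˣ eʸ)` are given by nested commutators. -/
theorem assocTerm_eq_term (x y : R) (n : ℕ) :
    assocTerm C x y n = term C (fun a b : R => a * b - b * a) x y n := by
  have key := inner_sum_assocTerm_apply (wordsVanish_subdiagonal C n x y)
    (by simpa using inner_subdiagonal C n 1 x) (by simpa using inner_subdiagonal C n 1 y)
  simp only [assocTerm_subdiagonal, inner_sum_apply, term_subdiagonal,
    inner_subdiagonal, Finset.sum_neg_distrib, neg_inj] at key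
  have key := congrFun (congrFun key (Fin.last n)) 0
  simp only [Matrix.sum_apply, Matrix.smul_apply, subdiagonal, toeplitz_last_zero, coeff_monomial,
    smul_ite, smul_zero, Finset.sum_ite_eq, Finset.mem_range] at key
  rw [if_pos (by omega), if_pos (by omega)] at key
  -- In degree `0` both sides are empty sums; otherwise the factor `n` produced by the Euler element
  -- can be cancelled.
  rcases Nat.eq_zero_or_pos n with rfl | hn
  · simp [assocTerm, term]
  · exact smul_right_injective R (show (n : C) ≠ 0 by exact_mod_cast hn.ne') key

/-- This is `exp (log (eˣ eʸ)) = eˣ eʸ` in degree `n`, read off in the bottom left corner of the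
matrices of size `n + 1`. Powers beyond `n` do not matter because the series has no constant term.
-/
theorem sum_coeff_bchSeries_pow (x y : R) (n : ℕ) :
    ∑ m ∈ Finset.range (n + 1), ((m.factorial : C)⁻¹) • coeff n (bchSeries C x y ^ m) =
      coeff n (expSeries C x * expSeries C y) := by
  have key := truncExp_sum_assocTerm (C := C) (wordsVanish_subdiagonal C n x y)
  simp only [assocTerm_subdiagonal] at key
  rw [← toeplitz_bchSeries, ← toeplitz_expSeries, ← toeplitz_expSeries, ← map_truncExp,
    ← map_mul] at key
  have key := congrFun (congrFun key (Fin.last n)) 0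
  rw [toeplitz_last_zero, toeplitz_last_zero, truncExp, map_sum] at key
  exact key

end Toeplitz

end BCH

/-! ### Well-ordering of iterated images under set-valued maps. -/

namespace Set

section IteratedChoice

variable {Γ : Type*} [LinearOrder Γ]

/-- The `n`-fold image of `B` under a set-valued map. -/
def choiceLevel (θ : Γ → Set Γ) (B : Set Γ) : ℕ → Set Γ
  | 0 => B
  | n + 1 => ⋃ γ ∈ choiceLevel θ B n, θ γ

/-- A set-valued map that strictly increases elements, maps well-ordered sets to well-ordered
sets, and reaches each element only finitely often from a well-ordered set. -/
structure IsNoetherianChoice (θ : Γ → Set Γ) : Prop where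
  lt : ∀ γ, ∀ δ ∈ θ γ, γ < δ
  isPWO : ∀ A : Set Γ, A.IsPWO → (⋃ γ ∈ A, θ γ).IsPWO
  finite : ∀ A : Set Γ, A.IsPWO → ∀ δ, {γ ∈ A | δ ∈ θ γ}.Finite

/-- Equality, or strict increase of the second component. -/
def eqOrSndLT (c d : ℕ × Γ) : Prop := c = d ∨ c.2 < d.2

instance : IsPreorder (ℕ × Γ) eqOrSndLT where
  refl _ := Or.inl rfl
  trans a b c hab hbc := by
    rcases hab with rfl | hab
    · exact hbc
    · rcases hbc with rfl | hbc
      · exact Or.inr hab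
      · exact Or.inr (hab.trans hbc)

variable {θ : Γ → Set Γ} {B : Set Γ}

/-- Recording the level together with the exponent, and allowing only equality or strict increase of
the exponent, yields well-ordering of the union and finiteness of the levels at once. The proof
takes a bad sequence that is minimal for the level and passes to predecessors. -/
theorem IsNoetherianChoice.partiallyWellOrderedOn (hθ : IsNoetherianChoice θ) (hB : B.IsPWO) :
    {c : ℕ × Γ | c.2 ∈ choiceLevel θ B c.1}.PartiallyWellOrderedOn eqOrSndLT := by
  rw [PartiallyWellOrderedOn.iff_not_exists_isMinBadSeq Prod.fst]
  rintro ⟨f, ⟨hfP, hbad⟩, hmin⟩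
  obtain ⟨g, hg | hg⟩ := Nat.exists_subseq_of_forall_mem_union (s := {c : ℕ × Γ | c.1 = 0})
    (t := {c : ℕ × Γ | c.1 ≠ 0}) f fun n => by
      by_cases h : (f n).1 = 0
      · exact Or.inl h
      · exact Or.inr h
  · obtain ⟨h, hh⟩ := hB.exists_monotone_subseq (f := fun n => (f (g n)).2) fun n => by
      have h1 : (f (g n)).2 ∈ choiceLevel θ B (f (g n)).1 := hfP _
      rw [show (f (g n)).1 = 0 from hg n] at h1
      exact h1
    have hlt : g (h 0) < g (h 1) := g.strictMono (h.strictMono one_pos)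
    refine hbad _ _ hlt ?_
    rcases (hh zero_le_one).lt_or_eq with h1 | h1
    · exact Or.inr h1
    · exact Or.inl (Prod.ext ((hg _).trans (hg _).symm) h1)
  · have hpred : ∀ n, ∃ p : ℕ × Γ, p.2 ∈ choiceLevel θ B p.1 ∧ p.1 + 1 = (f (g n)).1 ∧
        (f (g n)).2 ∈ θ p.2 := by
      intro n
      obtain ⟨m, hm⟩ := Nat.exists_eq_succ_of_ne_zero (hg n)
      have h1 : (f (g n)).2 ∈ choiceLevel θ B (f (g n)).1 := hfP _
      rw [hm] at h1
      simp only [choiceLevel, mem_iUnion] at h1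
      obtain ⟨γ, hγ, hδ⟩ := h1
      exact ⟨(m, γ), hγ, hm.symm, hδ⟩
    choose p hpP hprk hpθ using hpred
    -- A bad sequence of predecessors, started at its least index and spliced into `f` at that
    -- place, would be bad and smaller than `f`: a predecessor has a lower level, and its exponent
    -- lies below that of its successor.
    have hQ : (range p).PartiallyWellOrderedOn eqOrSndLT := by
      rw [PartiallyWellOrderedOn.iff_forall_not_isBadSeq]
      rintro q ⟨hq, hqbad⟩
      choose i hi using hq
      classical
      have hex : ∃ j, ∃ k, i k = j := ⟨_, 0, rfl⟩
      obtain ⟨k₀, hk₀⟩ := Nat.find_spec hex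
      have hk₀min : ∀ k, i k₀ ≤ i k := fun k => hk₀ ▸ Nat.find_min' hex ⟨k, rfl⟩
      refine hmin (g (i k₀)) (fun j => if j < g (i k₀) then f j else q (k₀ + (j - g (i k₀))))
        (fun j hj => (if_pos hj).symm) ?_ ⟨?_, ?_⟩
      · simp only [lt_irrefl, if_false, Nat.sub_self, add_zero]
        rw [← hi, ← hprk]
        exact Nat.lt_succ_self _
      · intro j
        dsimp only
        split_ifs
        · exact hfP j
        · rw [← hi]; exact hpP _
      · intro a b hab
        dsimp only
        split_ifs with ha hb hb
        · exact hbad a b hab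
        · rw [← hi]
          have hlt : a < g (i (k₀ + (b - g (i k₀)))) :=
            ha.trans_le (g.monotone (hk₀min _))
          intro hcon
          refine hbad _ _ hlt (Or.inr ?_)
          have h2 := hθ.lt _ _ (hpθ (i (k₀ + (b - g (i k₀)))))
          rcases hcon with hcon | hcon
          · rw [hcon]; exact h2
          · exact hcon.trans h2
        · omega
        · exact hqbad _ _ (by omega)
    obtain ⟨h, hh⟩ := hQ.exists_monotone_subseq fun n => mem_range_self n
    set A : Set Γ := Prod.snd '' range p with hA
    have hApwo : A.IsPWO := hQ.image_of_monotone_on fun a _ b _ hab => by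
      rcases hab with rfl | hab
      · exact le_rfl
      · exact hab.le
    have hAmem : ∀ n, (p n).2 ∈ A := fun n => ⟨_, mem_range_self n, rfl⟩
    obtain ⟨k, hk⟩ := (hθ.isPWO A hApwo).exists_monotone_subseq
      (f := fun n => (f (g (h n))).2) fun n => mem_biUnion (hAmem _) (hpθ _)
    have hmono : ∀ {a b : ℕ}, a < b → g (h (k a)) < g (h (k b)) := fun hab =>
      g.strictMono (h.strictMono (k.strictMono hab))
    -- The exponents are nondecreasing along this subsequence, and badness forbids strict increase.
    -- So a single exponent has all these predecessors, and two of them must share their exponent.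
    have hconst : ∀ n, (f (g (h (k n)))).2 = (f (g (h (k 0)))).2 := by
      intro n
      rcases Nat.eq_zero_or_pos n with rfl | hn
      · rfl
      · refine ((hk n.zero_le).lt_or_eq.resolve_left fun hlt => ?_).symm
        exact hbad _ _ (hmono hn) (Or.inr hlt)
    have hfin := hθ.finite A hApwo (f (g (h (k 0)))).2
    have hmaps : ∀ n, (p (h (k n))).2 ∈ {γ ∈ A | (f (g (h (k 0)))).2 ∈ θ γ} := fun n =>
      ⟨hAmem _, by rw [← hconst n]; exact hpθ _⟩
    have := hfin.to_subtype
    obtain ⟨a, b, hab, heq⟩ := Finite.exists_ne_map_eq_of_infinite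
      fun n => (⟨_, hmaps n⟩ : {γ ∈ A | (f (g (h (k 0)))).2 ∈ θ γ})
    wlog hlt : a < b generalizing a b
    · exact this b a hab.symm heq.symm (lt_of_le_of_ne (not_lt.1 hlt) hab.symm)
    have heq' : (p (h (k a))).2 = (p (h (k b))).2 := congrArg Subtype.val heq
    refine hbad _ _ (hmono hlt) (Or.inl (Prod.ext ?_ ((hconst a).trans (hconst b).symm)))
    rcases hh (k a) (k b) (k.monotone hlt.le) with h1 | h1
    · rw [← hprk, ← hprk, h1]
    · exact absurd heq' h1.ne

theorem IsNoetherianChoice.isPWO_iUnion_choiceLevel (hθ : IsNoetherianChoice θ) (hB : B.IsPWO) :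
    (⋃ n, choiceLevel θ B n).IsPWO := by
  have h := (hθ.partiallyWellOrderedOn hB).image_of_monotone_on (f := Prod.snd) (r' := (· ≤ ·))
    fun a _ b _ hab => by
      rcases hab with rfl | hab
      · exact le_rfl
      · exact hab.le
  refine IsPWO.mono h fun δ hδ => ?_
  obtain ⟨n, hn⟩ := mem_iUnion.1 hδ
  exact ⟨(n, δ), hn, rfl⟩

/-- One exponent at infinitely many levels would give a bad sequence: the pairs differ, but their
exponents do not increase. -/
theorem IsNoetherianChoice.finite_setOf_mem_choiceLevel (hθ : IsNoetherianChoice θ) (hB : B.IsPWO)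
    (δ : Γ) : {n | δ ∈ choiceLevel θ B n}.Finite := by
  by_contra hinf
  let e := Set.Infinite.natEmbedding _ hinf
  obtain ⟨m, n, hlt, h⟩ := (hθ.partiallyWellOrderedOn hB).exists_lt
    (f := fun m => ((e m : ℕ), δ)) fun m => (e m).2
  rcases h with h | h
  · exact hlt.ne (e.injective (Subtype.ext (Prod.ext_iff.1 h).1))
  · exact lt_irrefl _ h

end IteratedChoice

end Set

/-! ### Summable families and strongly linear operators. -/

namespace HahnField

universe u v

section Sums

variable {Γ : Type u} {C : Type v} [LinearOrder Γ] [Field C]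

theorem hasHahnSum_iff {I : Type*} {s : I → HahnSeries Γ C} {h : HahnSeries Γ C} :
    HasHahnSum s h ↔ (⋃ i, (s i).support).IsPWO ∧ (∀ γ, {i | (s i).coeff γ ≠ 0}.Finite) ∧
      ∀ γ, h.coeff γ = ∑ᶠ i, (s i).coeff γ := by
  constructor
  · rintro ⟨F, rfl, rfl⟩
    exact ⟨F.isPWO_iUnion_support, F.finite_co_support, fun _ => rfl⟩
  · rintro ⟨h1, h2, h3⟩
    refine ⟨⟨s, h1, h2⟩, rfl, ?_⟩
    ext γ
    exact (h3 γ).symm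

theorem HasHahnSum.unique {I : Type*} {s : I → HahnSeries Γ C} {h h' : HahnSeries Γ C}
    (H : HasHahnSum s h) (H' : HasHahnSum s h') : h = h' := by
  ext γ
  rw [(hasHahnSum_iff.1 H).2.2, (hasHahnSum_iff.1 H').2.2]

theorem HasHahnSum.add {I : Type*} {s t : I → HahnSeries Γ C} {g h : HahnSeries Γ C}
    (H : HasHahnSum s g) (H' : HasHahnSum t h) : HasHahnSum (fun i => s i + t i) (g + h) := by
  obtain ⟨F, rfl, rfl⟩ := H
  obtain ⟨G, rfl, rfl⟩ := H'
  exact ⟨F + G, rfl, HahnSeries.SummableFamily.hsum_add⟩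

theorem HasHahnSum.comp_equiv {I J : Type*} (e : J ≃ I) {s : I → HahnSeries Γ C}
    {h : HahnSeries Γ C} (H : HasHahnSum s h) : HasHahnSum (fun j => s (e j)) h := by
  obtain ⟨F, rfl, rfl⟩ := H
  exact ⟨F.Equiv e.symm, rfl, HahnSeries.SummableFamily.hsum_equiv _ _⟩

theorem hasHahnSum_single (f : HahnSeries Γ C) :
    HasHahnSum (fun γ => HahnSeries.single γ (f.coeff γ)) f := by
  classical
  rw [hasHahnSum_iff]
  refine ⟨f.isPWO_support.mono (Set.iUnion_subset fun γ δ hδ => ?_), fun γ => ?_, fun γ => ?_⟩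
  · rw [HahnSeries.mem_support, HahnSeries.coeff_single] at hδ
    split_ifs at hδ with h
    · rw [h]; exact hδ
    · exact absurd rfl hδ
  · refine (Set.finite_singleton γ).subset fun δ hδ => ?_
    by_contra hne
    exact hδ (HahnSeries.coeff_single_of_ne (Ne.symm hne))
  · rw [finsum_eq_single _ γ fun δ hδ => HahnSeries.coeff_single_of_ne (Ne.symm hδ)]
    rw [HahnSeries.coeff_single_same]

theorem exists_hasHahnSum {S : ℕ → Set Γ} (hS : (⋃ n, S n).IsPWO)
    (hfin : ∀ δ, {n | δ ∈ S n}.Finite) {s : ℕ → HahnSeries Γ C} (hs : ∀ n, (s n).support ⊆ S n) :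
    ∃ h, HasHahnSum s h := by
  refine ⟨_, ⟨s, hS.mono (Set.iUnion_mono hs), fun δ => (hfin δ).subset fun n hn => hs n hn⟩,
    rfl, rfl⟩

/-- Reduces identities between infinite sums to finite sums, one exponent at a time. -/
theorem HasHahnSum.coeff_eq_sum_range {s : ℕ → HahnSeries Γ C} {h : HahnSeries Γ C}
    (H : HasHahnSum s h) {δ : Γ} {N : ℕ} (hN : ∀ n, N ≤ n → (s n).coeff δ = 0) :
    h.coeff δ = ∑ n ∈ Finset.range N, (s n).coeff δ := by
  rw [(hasHahnSum_iff.1 H).2.2]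
  refine finsum_eq_sum_of_support_subset _ fun n hn => ?_
  rw [Finset.coe_range, Set.mem_Iio]
  by_contra hlt
  exact hn (hN n (not_lt.1 hlt))

theorem exists_forall_ge_notMem {α : Type*} {S : ℕ → Set α} {δ : α} (hfin : {n | δ ∈ S n}.Finite) :
    ∃ N, ∀ n, N ≤ n → δ ∉ S n := by
  obtain ⟨N, hN⟩ := hfin.bddAbove
  exact ⟨N + 1, fun n hn hmem => by have := hN hmem; omega⟩

theorem CommutesWithSums.nat {T : HahnSeries Γ C → HahnSeries Γ C} (hT : CommutesWithSums T)
    {s : ℕ → HahnSeries Γ C} {h : HahnSeries Γ C} (H : HasHahnSum s h) :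
    HasHahnSum (fun n => T (s n)) (T h) :=
  (hT _ _ _ (H.comp_equiv Equiv.ulift)).comp_equiv Equiv.ulift.symm

theorem IsContracting.lt_of_mem_support {T : Module.End C (HahnSeries Γ C)} (hT : IsContracting T)
    {γ δ : Γ} (hδ : δ ∈ (T (HahnSeries.single γ 1)).support) : γ < δ := by
  have h := (hT (HahnSeries.single γ 1) (HahnSeries.single_ne_zero one_ne_zero)).2
  rw [Dominated, not_le, HahnSeries.orderTop_single one_ne_zero] at h
  exact WithTop.coe_lt_coe.1 (h.trans_le (HahnSeries.orderTop_le_of_coeff_ne_zero hδ))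

variable [AddCommGroup Γ] [IsOrderedAddMonoid Γ]

theorem HasHahnSum.const_mul {I : Type*} {s : I → HahnSeries Γ C} {h : HahnSeries Γ C}
    (H : HasHahnSum s h) (x : HahnSeries Γ C) : HasHahnSum (fun i => x * s i) (x * h) := by
  obtain ⟨F, rfl, rfl⟩ := H
  exact ⟨x • F, rfl, HahnSeries.SummableFamily.hsum_smul⟩

theorem HasHahnSum.mul_const {I : Type*} {s : I → HahnSeries Γ C} {h : HahnSeries Γ C}
    (H : HasHahnSum s h) (x : HahnSeries Γ C) : HasHahnSum (fun i => s i * x) (h * x) := by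
  simpa only [mul_comm] using H.const_mul x

theorem HasHahnSum.const_smul {I : Type*} {s : I → HahnSeries Γ C} {h : HahnSeries Γ C}
    (H : HasHahnSum s h) (c : C) : HasHahnSum (fun i => c • s i) (c • h) := by
  simpa only [HahnSeries.C_mul_eq_smul] using H.const_mul (HahnSeries.C c)

/-- The algebra of strongly linear operators on a Hahn field. -/
noncomputable def strongLinear (Γ : Type u) (C : Type v) [AddCommGroup Γ] [LinearOrder Γ] [Field C]
    [IsOrderedAddMonoid Γ] : Subalgebra C (Module.End C (HahnSeries Γ C)) where
  carrier := {T | CommutesWithSums T}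
  mul_mem' ha hb I s h H := ha I _ _ (hb I s h H)
  add_mem' ha hb I s h H := (ha I s h H).add (hb I s h H)
  algebraMap_mem' c _ _ _ H := H.const_smul c

end Sums

/-! ### Supports of words in two operators. -/

section Levels

variable {Γ : Type u} {C : Type v} [AddCommGroup Γ] [LinearOrder Γ] [Field C]
  [IsOrderedAddMonoid Γ]

theorem hasHahnSum_apply {T : Module.End C (HahnSeries Γ C)} (hT : T ∈ strongLinear Γ C)
    (f : HahnSeries Γ C) :
    HasHahnSum (fun γ => f.coeff γ • T (HahnSeries.single γ 1)) (T f) := by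
  have h := hT Γ _ _ (hasHahnSum_single f)
  have e : ∀ γ, T (HahnSeries.single γ (f.coeff γ)) = f.coeff γ • T (HahnSeries.single γ 1) := by
    intro γ
    rw [← map_smul]
    congr 1
    ext δ
    simp [HahnSeries.coeff_single]
  simpa only [e] using h

theorem support_apply_subset {T : Module.End C (HahnSeries Γ C)} (hT : T ∈ strongLinear Γ C)
    (f : HahnSeries Γ C) :
    (T f).support ⊆ ⋃ γ ∈ f.support, (T (HahnSeries.single γ 1)).support := by
  obtain ⟨F, hF, hsum⟩ := hasHahnSum_apply hT f
  intro δ hδ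
  rw [← hsum] at hδ
  obtain ⟨γ, hγ⟩ := Set.mem_iUnion.1 (HahnSeries.SummableFamily.support_hsum_subset hδ)
  rw [hF, HahnSeries.mem_support, HahnSeries.coeff_smul] at hγ
  exact Set.mem_biUnion (x := γ) (left_ne_zero_of_smul hγ) (right_ne_zero_of_smul hγ)

theorem isPWO_biUnion_support {T : Module.End C (HahnSeries Γ C)} (hT : T ∈ strongLinear Γ C)
    {A : Set Γ} (hA : A.IsPWO) : (⋃ γ ∈ A, (T (HahnSeries.single γ 1)).support).IsPWO ∧
      ∀ δ, {γ ∈ A | δ ∈ (T (HahnSeries.single γ 1)).support}.Finite := by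
  classical
  -- Strong linearity, applied to the series with coefficient `1` on all of `A`, makes the images of
  -- the monomials with exponent in `A` a summable family.
  let f : HahnSeries Γ C := ⟨fun γ => if γ ∈ A then 1 else 0, hA.mono fun γ hγ => by
    by_contra h
    exact hγ (if_neg h)⟩
  have hf : ∀ γ ∈ A, f.coeff γ = 1 := fun γ hγ => if_pos hγ
  obtain ⟨h1, h2, -⟩ := hasHahnSum_iff.1 (hasHahnSum_apply hT f)
  refine ⟨h1.mono ?_, fun δ => (h2 δ).subset ?_⟩
  · refine Set.iUnion₂_subset fun γ hγ => ?_
    refine Set.Subset.trans ?_ (Set.subset_iUnion _ γ)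
    rw [hf γ hγ, one_smul]
  · rintro γ ⟨hγ, hδ⟩
    rw [Set.mem_ofPred_eq, hf γ hγ, one_smul]
    exact hδ

/-- The exponents of the images of a monomial under one of two operators. -/
def opChoice (X Y : Module.End C (HahnSeries Γ C)) (γ : Γ) : Set Γ :=
  (X (HahnSeries.single γ 1)).support ∪ (Y (HahnSeries.single γ 1)).support

theorem isNoetherianChoice_opChoice {X Y : Module.End C (HahnSeries Γ C)}
    (hX : X ∈ strongLinear Γ C) (hY : Y ∈ strongLinear Γ C) (hX' : IsContracting X)
    (hY' : IsContracting Y) : Set.IsNoetherianChoice (opChoice X Y) where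
  lt γ δ h := h.elim hX'.lt_of_mem_support hY'.lt_of_mem_support
  isPWO A hA := by
    simp only [opChoice, Set.iUnion_union_distrib]
    exact (isPWO_biUnion_support hX hA).1.union (isPWO_biUnion_support hY hA).1
  finite A hA δ := by
    refine (((isPWO_biUnion_support hX hA).2 δ).union ((isPWO_biUnion_support hY hA).2 δ)).subset ?_
    rintro γ ⟨hγ, h⟩
    exact h.imp (fun h => ⟨hγ, h⟩) fun h => ⟨hγ, h⟩

/-- The operators that are homogeneous polynomials of degree `n` in `X` and `Y`. -/
noncomputable def homogeneousOps (X Y : Module.End C (HahnSeries Γ C)) (n : ℕ) :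
    Submodule C (Module.End C (HahnSeries Γ C)) :=
  Submodule.span C {X, Y} ^ n

variable {X Y : Module.End C (HahnSeries Γ C)}

theorem homogeneousOps_le_strongLinear (hX : X ∈ strongLinear Γ C) (hY : Y ∈ strongLinear Γ C)
    (n : ℕ) : homogeneousOps X Y n ≤ Subalgebra.toSubmodule (strongLinear Γ C) := by
  intro T hT
  induction n generalizing T with
  | zero =>
    obtain ⟨c, rfl⟩ := Submodule.mem_one.1 (by simpa [homogeneousOps] using hT)
    exact Subalgebra.algebraMap_mem _ c
  | succ n ih =>
    rw [homogeneousOps, pow_succ] at hT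
    refine Submodule.mul_induction_on hT (fun A hA B hB => ?_) fun A B hA hB => ?_
    · refine (strongLinear Γ C).mul_mem (ih hA) ?_
      have : Submodule.span C {X, Y} ≤ Subalgebra.toSubmodule (strongLinear Γ C) := by
        rw [Submodule.span_le]
        rintro _ (rfl | rfl)
        · exact hX
        · exact hY
      exact this hB
    · exact (strongLinear Γ C).add_mem hA hB

/-- Each letter applied on the left sends every exponent of the support into its choice set, so the
degree counts the levels. -/
theorem support_subset_choiceLevel (hX : X ∈ strongLinear Γ C) (hY : Y ∈ strongLinear Γ C)
    (f : HahnSeries Γ C) {n : ℕ} {T : Module.End C (HahnSeries Γ C)}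
    (hT : T ∈ homogeneousOps X Y n) :
    (T f).support ⊆ Set.choiceLevel (opChoice X Y) f.support n := by
  induction n generalizing T with
  | zero =>
    obtain ⟨c, rfl⟩ := Submodule.mem_one.1 (by simpa [homogeneousOps] using hT)
    intro δ hδ
    rw [Module.algebraMap_end_apply, HahnSeries.mem_support, HahnSeries.coeff_smul] at hδ
    exact right_ne_zero_of_smul hδ
  | succ n ih =>
    rw [homogeneousOps, pow_succ'] at hT
    refine Submodule.mul_induction_on hT (fun A hA B hB => ?_) fun A B hA hB => ?_
    · have hA1 : A ∈ homogeneousOps X Y 1 := by rwa [homogeneousOps, pow_one]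
      refine (support_apply_subset (homogeneousOps_le_strongLinear hX hY 1 hA1) (B f)).trans ?_
      refine Set.iUnion₂_mono' fun γ hγ => ⟨γ, ih hB hγ, ?_⟩
      refine Submodule.span_induction (p := fun A _ => (A (HahnSeries.single γ 1)).support ⊆
        opChoice X Y γ) ?_ ?_ ?_ ?_ hA
      · rintro _ (rfl | rfl)
        · exact Set.subset_union_left
        · exact Set.subset_union_right
      · simp
      · intro A B _ _ hA hB
        exact (HahnSeries.support_add_subset _ _).trans (Set.union_subset hA hB)
      · intro c A _ hA δ hδ
        rw [LinearMap.smul_apply, HahnSeries.mem_support, HahnSeries.coeff_smul] at hδ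
        exact hA (right_ne_zero_of_smul hδ)
    · exact (HahnSeries.support_add_subset _ _).trans (Set.union_subset hA hB)

theorem mul_mem_homogeneousOps {S T : Module.End C (HahnSeries Γ C)} {m n : ℕ}
    (hS : S ∈ homogeneousOps X Y m) (hT : T ∈ homogeneousOps X Y n) :
    S * T ∈ homogeneousOps X Y (m + n) := by
  rw [homogeneousOps, pow_add]
  exact Submodule.mul_mem_mul hS hT

theorem prod_mem_homogeneousOps (l : List (Module.End C (HahnSeries Γ C)))
    (hl : ∀ T ∈ l, T = X ∨ T = Y) : l.prod ∈ homogeneousOps X Y l.length := by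
  induction l with
  | nil => simp [homogeneousOps, Submodule.one_le.1 le_rfl]
  | cons T l ih =>
    rw [List.prod_cons, List.length_cons, add_comm]
    refine mul_mem_homogeneousOps ?_ (ih fun S hS => hl S (List.mem_cons_of_mem _ hS))
    rw [homogeneousOps, pow_one]
    exact Submodule.subset_span (hl T List.mem_cons_self)

open PowerSeries

/-- The coefficient of degree `n` is homogeneous of degree `n` in `X` and `Y`. -/
def IsGraded (X Y : Module.End C (HahnSeries Γ C)) (P : (Module.End C (HahnSeries Γ C))⟦X⟧) :
    Prop :=
  ∀ n, coeff n P ∈ homogeneousOps X Y n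

theorem IsGraded.mul {P Q : (Module.End C (HahnSeries Γ C))⟦X⟧} (hP : IsGraded X Y P)
    (hQ : IsGraded X Y Q) : IsGraded X Y (P * Q) := by
  intro n
  rw [coeff_mul]
  refine Submodule.sum_mem _ fun q hq => ?_
  rw [← Finset.HasAntidiagonal.mem_antidiagonal.1 hq]
  exact mul_mem_homogeneousOps (hP _) (hQ _)

theorem IsGraded.pow {P : (Module.End C (HahnSeries Γ C))⟦X⟧} (hP : IsGraded X Y P) (m : ℕ) :
    IsGraded X Y (P ^ m) := by
  induction m with
  | zero =>
    intro n
    rw [pow_zero, coeff_one]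
    split_ifs with h
    · rw [h]; exact prod_mem_homogeneousOps [] (by simp)
    · exact Submodule.zero_mem _
  | succ m ih => rw [pow_succ]; exact ih.mul hP

theorem isGraded_expSeries {T : Module.End C (HahnSeries Γ C)} (hT : T = X ∨ T = Y) :
    IsGraded X Y (BCH.expSeries C T) := by
  intro n
  rw [BCH.expSeries, coeff_mk]
  refine Submodule.smul_mem _ _ ?_
  simpa using prod_mem_homogeneousOps (X := X) (Y := Y) (List.replicate n T) fun S hS => by
    rwa [List.eq_of_mem_replicate hS]

theorem isGraded_bchSeries : IsGraded X Y (BCH.bchSeries C X Y) := by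
  intro n
  rw [BCH.bchSeries, coeff_mk, BCH.assocTerm]
  refine Submodule.sum_mem _ fun k _ => Submodule.sum_mem _ fun p hp => Submodule.smul_mem _ _ ?_
  have := prod_mem_homogeneousOps (X := X) (Y := Y) (BCH.word X Y p) fun S hS => BCH.mem_word hS
  rwa [BCH.length_word_of_mem_exponents X Y hp] at this

/-- The value at `f` of a power series of operators, specialised at `1`. -/
def HasValue (P : (Module.End C (HahnSeries Γ C))⟦X⟧) (f g : HahnSeries Γ C) : Prop :=
  HasHahnSum (fun n => coeff n P f) g

/-! ### Evaluation of graded power series of operators. -/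

section Values

variable (hX : X ∈ strongLinear Γ C) (hY : Y ∈ strongLinear Γ C) (hX' : IsContracting X)
  (hY' : IsContracting Y)

include hX hY hX' hY'

theorem IsGraded.exists_hasValue {P : (Module.End C (HahnSeries Γ C))⟦X⟧} (hP : IsGraded X Y P)
    (f : HahnSeries Γ C) : ∃ g, HasValue P f g := by
  have hθ := isNoetherianChoice_opChoice hX hY hX' hY'
  exact exists_hasHahnSum (hθ.isPWO_iUnion_choiceLevel f.isPWO_support)
    (hθ.finite_setOf_mem_choiceLevel f.isPWO_support)
    fun n => support_subset_choiceLevel hX hY f (hP n)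

/-- The bound is uniform over all operators of a given degree. Hence the rearrangements of double
series below are finite at each exponent. -/
theorem exists_degree_bound (f : HahnSeries Γ C) (δ : Γ) : ∃ N, ∀ n, N ≤ n →
    ∀ T ∈ homogeneousOps X Y n, (T f).coeff δ = 0 := by
  have hθ := isNoetherianChoice_opChoice hX hY hX' hY'
  obtain ⟨N, hN⟩ := exists_forall_ge_notMem (hθ.finite_setOf_mem_choiceLevel f.isPWO_support δ)
  refine ⟨N, fun n hn T hT => ?_⟩
  by_contra hne
  exact hN n hn (support_subset_choiceLevel hX hY f hT hne)

theorem HasValue.mul {P Q : (Module.End C (HahnSeries Γ C))⟦X⟧} (hP : IsGraded X Y P)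
    (hQ : IsGraded X Y Q) {f g h : HahnSeries Γ C} (hf : HasValue Q f g) (hg : HasValue P g h) :
    HasValue (P * Q) f h := by
  obtain ⟨h', hh'⟩ := (hP.mul hQ).exists_hasValue hX hY hX' hY' f
  suffices h' = h by rwa [← this]
  ext δ
  obtain ⟨N, hN⟩ := exists_degree_bound hX hY hX' hY' f δ
  rw [hh'.coeff_eq_sum_range fun n hn => hN n hn _ (hP.mul hQ n)]
  have hi : ∀ i, (coeff i P g).coeff δ =
      ∑ j ∈ Finset.range N, (coeff i P (coeff j Q f)).coeff δ := by
    intro i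
    -- Strong linearity lets the coefficient of `P` pass through the infinite sum that defines `g`.
    have h1 := CommutesWithSums.nat (homogeneousOps_le_strongLinear hX hY i (hP i)) hf
    exact h1.coeff_eq_sum_range fun j hj =>
      hN (i + j) (by omega) _ (mul_mem_homogeneousOps (hP i) (hQ j))
  have hzero : ∀ i j, N ≤ i + j → (coeff i P (coeff j Q f)).coeff δ = 0 := fun i j hij =>
    hN (i + j) hij _ (mul_mem_homogeneousOps (hP i) (hQ j))
  rw [hg.coeff_eq_sum_range (N := N) fun i hi' => by
    rw [hi]; exact Finset.sum_eq_zero fun j _ => hzero i j (by omega)]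
  simp only [hi]
  have e1 : ∀ n, (coeff n (P * Q) f).coeff δ = ∑ q ∈ Finset.HasAntidiagonal.antidiagonal n,
      (coeff q.1 P (coeff q.2 Q f)).coeff δ := by
    intro n
    rw [coeff_mul, LinearMap.sum_apply, HahnSeries.coeff_sum]
    rfl
  simp only [e1]
  rw [← Finset.sum_product', Finset.sum_sigma']
  -- The triangle `i + j < N` embeds into the square; the rest of the square vanishes by the degree
  -- bound.
  refine Finset.sum_of_injOn (fun x => x.2) ?_ ?_ ?_ ?_
  · rintro ⟨n, q⟩ hx ⟨n', q'⟩ hx' h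
    simp only [Finset.coe_sigma, Set.mem_sigma_iff, Finset.mem_coe,
      Finset.HasAntidiagonal.mem_antidiagonal] at hx hx' h
    obtain rfl := h
    obtain rfl := hx.2.symm.trans hx'.2
    rfl
  · rintro ⟨n, q⟩ hx
    simp only [Finset.coe_sigma, Set.mem_sigma_iff, Finset.mem_coe, Finset.mem_range,
      Finset.HasAntidiagonal.mem_antidiagonal] at hx
    simp only [Finset.coe_product, Set.mem_prod, Finset.mem_coe, Finset.mem_range]
    omega
  · rintro ⟨i, j⟩ _ hx
    refine hzero i j ?_
    by_contra hlt
    refine hx ⟨⟨i + j, (i, j)⟩, ?_, rfl⟩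
    simpa using hlt
  · rintro ⟨n, q⟩ _
    rfl

theorem HasValue.pow {P : (Module.End C (HahnSeries Γ C))⟦X⟧} (hP : IsGraded X Y P)
    {T : Module.End C (HahnSeries Γ C)} (hT : ∀ f, HasValue P f (T f)) (m : ℕ)
    (f : HahnSeries Γ C) : HasValue (P ^ m) f ((T ^ m) f) := by
  induction m with
  | zero =>
    refine ⟨HahnSeries.SummableFamily.single 0 f, ?_, HahnSeries.SummableFamily.hsum_single _ _⟩
    ext1 n
    rw [HahnSeries.SummableFamily.single_toFun, pow_zero, coeff_one]
    rcases eq_or_ne n 0 with rfl | hn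
    · simp
    · simp [hn]
  | succ m ih =>
    rw [pow_succ', pow_succ']
    exact HasValue.mul hX hY hX' hY' hP (hP.pow m) ih (hT _)

variable [CharZero C]

/-- If `T` is the value of the Baker-Campbell-Hausdorff series, then `exp T = exp X ∘ exp Y`. -/
theorem HasValue.exp_bchSeries {T : Module.End C (HahnSeries Γ C)}
    (hT : ∀ f, HasValue (BCH.bchSeries C X Y) f (T f)) {f g h k : HahnSeries Γ C}
    (hf : HasValue (BCH.expSeries C Y) f g) (hg : HasValue (BCH.expSeries C X) g h)
    (hk : HasValue (BCH.expSeries C T) f k) : k = h := by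
  have hE := HasValue.mul hX hY hX' hY' (isGraded_expSeries (Or.inl rfl))
    (isGraded_expSeries (Or.inr rfl)) hf hg
  have hgr := (isGraded_expSeries (X := X) (Y := Y) (Or.inl rfl)).mul
    (isGraded_expSeries (X := X) (Y := Y) (Or.inr rfl))
  have hB : IsGraded X Y (BCH.bchSeries C X Y) := isGraded_bchSeries
  ext δ
  obtain ⟨N, hN⟩ := exists_degree_bound hX hY hX' hY' f δ
  rw [hE.coeff_eq_sum_range fun n hn => hN n hn _ (hgr n)]
  have hm : ∀ m, ((T ^ m) f).coeff δ =
      ∑ n ∈ Finset.range N, (coeff n (BCH.bchSeries C X Y ^ m) f).coeff δ := fun m =>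
    (HasValue.pow hX hY hX' hY' hB hT m f).coeff_eq_sum_range fun n hn =>
      hN n hn _ (hB.pow m n)
  have hzero : ∀ m n, n < m → (coeff n (BCH.bchSeries C X Y ^ m) f).coeff δ = 0 := fun m n hnm => by
    rw [BCH.coeff_bchSeries_pow_eq_zero C X Y hnm]; rfl
  have hexp : ∀ m, (coeff m (BCH.expSeries C T) f).coeff δ = (m.factorial : C)⁻¹ *
      ∑ n ∈ Finset.range N, (coeff n (BCH.bchSeries C X Y ^ m) f).coeff δ := fun m => by
    rw [BCH.expSeries, coeff_mk, LinearMap.smul_apply, HahnSeries.coeff_smul, hm, smul_eq_mul]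
  rw [hk.coeff_eq_sum_range (N := N) fun m hNm => by
    rw [hexp, Finset.sum_eq_zero, mul_zero]
    intro n hn
    exact hzero m n (by rw [Finset.mem_range] at hn; omega)]
  simp only [hexp, Finset.mul_sum]
  -- Summing over the powers `m` first leaves, in each degree `n`, the formal identity `exp (log (eˣ
  -- eʸ)) = eˣ eʸ`.
  rw [Finset.sum_comm]
  refine Finset.sum_congr rfl fun n hn => ?_
  rw [← BCH.sum_coeff_bchSeries_pow, LinearMap.sum_apply, HahnSeries.coeff_sum]
  symm
  refine Finset.sum_subset_zero_on_sdiff ?_ ?_ ?_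
  · intro m hm
    rw [Finset.mem_range] at *
    omega
  · intro m hm
    rw [Finset.mem_sdiff, Finset.mem_range, Finset.mem_range] at hm
    rw [hzero m n (by omega), mul_zero]
  · intro m _
    rw [LinearMap.smul_apply, HahnSeries.coeff_smul, smul_eq_mul]

end Values

end Levels

end HahnField

/-! ### The terms of degrees one and two. -/

namespace BCH

section LowDegree

open PowerSeries

variable (C : Type*) [Field C] [CharZero C] {R : Type*} [Ring R] [Algebra C R]

theorem assocTerm_one (x y : R) : assocTerm C x y 1 = x + y := by
  have h := sum_coeff_bchSeries_pow C x y 1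
  simpa [Finset.sum_range_succ, coeff_mul, coeff_one, Finset.Nat.antidiagonal_succ, expSeries,
    bchSeries, add_comm] using h

theorem two_smul_assocTerm_two (x y : R) : (2 : C) • assocTerm C x y 2 = x * y - y * x := by
  have h := sum_coeff_bchSeries_pow C x y 2
  have h0 : assocTerm C x y 0 = 0 := by simp [assocTerm]
  have h2 : (2 : C) ≠ 0 := two_ne_zero
  simp only [Finset.sum_range_succ, Finset.sum_range_zero, pow_zero, pow_one, coeff_one, pow_two,
    coeff_mul, Finset.Nat.sum_antidiagonal_eq_sum_range_succ_mk, expSeries, bchSeries, coeff_mk,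
    Nat.sub_zero, Nat.sub_self, Nat.reduceSub, h0, assocTerm_one, Nat.factorial] at h
  have h3 := congrArg (fun z => (2 : C) • z) h
  simp only [OfNat.ofNat_ne_zero, if_false, smul_zero, zero_add, mul_zero, zero_mul, add_zero,
    Nat.cast_one, inv_one, one_smul, one_mul, mul_one, Nat.succ_eq_add_one, Nat.reduceAdd,
    Nat.cast_ofNat, smul_add, smul_smul, mul_inv_cancel₀ h2, mul_smul_comm] at h3
  rw [two_smul C (x * y), add_mul, mul_add, mul_add] at h3
  rw [eq_sub_of_add_eq h3]
  abel

end LowDegree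

end BCH

/-! ### Valuation estimates for the bracket and its iterates. -/

namespace HahnField

universe u v

section OrderTop

variable {Γ : Type u} {C : Type v} [LinearOrder Γ] [Field C]

theorem strictlyDominated_iff {f g : HahnSeries Γ C} :
    ValuedGroup.StrictlyDominated Dominated f g ↔ g.orderTop < f.orderTop := by
  rw [ValuedGroup.StrictlyDominated, Dominated, Dominated, not_le]
  exact and_iff_right_of_imp le_of_lt

theorem lt_orderTop_add {a : WithTop Γ} {f g : HahnSeries Γ C} (hf : a < f.orderTop)
    (hg : a < g.orderTop) : a < (f + g).orderTop :=
  (lt_min hf hg).trans_le HahnSeries.min_orderTop_le_orderTop_add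

theorem le_orderTop_add {a : WithTop Γ} {f g : HahnSeries Γ C} (hf : a ≤ f.orderTop)
    (hg : a ≤ g.orderTop) : a ≤ (f + g).orderTop :=
  (le_min hf hg).trans HahnSeries.min_orderTop_le_orderTop_add

theorem lt_orderTop_sub {a : WithTop Γ} {f g : HahnSeries Γ C} (hf : a < f.orderTop)
    (hg : a < g.orderTop) : a < (f - g).orderTop :=
  (lt_min hf hg).trans_le HahnSeries.min_orderTop_le_orderTop_sub

theorem lt_orderTop_sub_comm {a : WithTop Γ} {f g : HahnSeries Γ C} :
    a < (f - g).orderTop ↔ a < (g - f).orderTop := by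
  rw [← HahnSeries.orderTop_neg, neg_sub]

theorem orderTop_eq_of_lt_sub {f g : HahnSeries Γ C} (h : g.orderTop < (f - g).orderTop) :
    f.orderTop = g.orderTop := by
  simpa using HahnSeries.orderTop_add_eq_left h

end OrderTop

section Bracket

variable {Γ : Type u} {C : Type v} [AddCommGroup Γ] [LinearOrder Γ] [Field C]
  [IsOrderedAddMonoid Γ] {D : Derivation C (HahnSeries Γ C) (HahnSeries Γ C)}

theorem mem_Cont {f : HahnSeries Γ C} :
    f ∈ Cont D ↔ ∀ h, h ≠ 0 → h.orderTop < (f * D h).orderTop := by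
  simp only [Cont, Set.mem_ofPred_eq, IsContracting, strictlyDominated_iff]

theorem mem_Cont_of_le {f g : HahnSeries Γ C} (hf : f ∈ Cont D) (h : f.orderTop ≤ g.orderTop) :
    g ∈ Cont D := by
  rw [mem_Cont] at hf ⊢
  intro k hk
  refine (hf k hk).trans_le ?_
  rw [HahnSeries.orderTop_mul, HahnSeries.orderTop_mul]
  gcongr

theorem zero_mem_Cont : (0 : HahnSeries Γ C) ∈ Cont D := by
  rw [mem_Cont]
  intro h hh
  rw [zero_mul, HahnSeries.orderTop_zero, HahnSeries.orderTop_lt_top]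
  exact hh

theorem add_mem_Cont {f g : HahnSeries Γ C} (hf : f ∈ Cont D) (hg : g ∈ Cont D) :
    f + g ∈ Cont D := by
  rw [mem_Cont] at *
  intro h hh
  rw [add_mul]
  exact lt_orderTop_add (hf h hh) (hg h hh)

theorem neg_mem_Cont {f : HahnSeries Γ C} (hf : f ∈ Cont D) : -f ∈ Cont D :=
  mem_Cont_of_le hf HahnSeries.orderTop_neg.ge

theorem bracket_swap (f g : HahnSeries Γ C) : bracket D g f = -bracket D f g := by
  rw [bracket, bracket]; ring

theorem bracket_self (f : HahnSeries Γ C) : bracket D f f = 0 := by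
  rw [bracket]; ring

theorem bracket_neg_left (f g : HahnSeries Γ C) : bracket D (-f) g = -bracket D f g := by
  rw [bracket, bracket, map_neg]; ring

theorem bracket_neg_right (f g : HahnSeries Γ C) : bracket D f (-g) = -bracket D f g := by
  rw [bracket, bracket, map_neg]; ring

theorem bracket_zero_right (f : HahnSeries Γ C) : bracket D f 0 = 0 := by
  simp [bracket]

/-- The part `f ∂(g)` is small since `f∂` is contracting. For `∂(f) g`, contraction applied to `f`
itself gives `f ∂(f) ≺ f`, so `∂(f) ≺ 1`. -/
theorem lt_orderTop_bracket {f g : HahnSeries Γ C} (hf : f ∈ Cont D) (hg : g ≠ 0) :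
    g.orderTop < (bracket D f g).orderTop := by
  rw [mem_Cont] at hf
  refine lt_orderTop_sub (hf g hg) ?_
  rcases eq_or_ne f 0 with rfl | hf0
  · simpa using hg
  · have h1 := hf f hf0
    rw [HahnSeries.orderTop_mul] at h1 ⊢
    have hpos : 0 < (D f).orderTop := by
      by_contra hle
      refine not_le.2 h1 ?_
      calc f.orderTop + (D f).orderTop ≤ f.orderTop + 0 := by gcongr; exact not_lt.1 hle
        _ = f.orderTop := add_zero _
    obtain ⟨γ, hγ⟩ := WithTop.ne_top_iff_exists.1 (HahnSeries.orderTop_ne_top.2 hg)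
    rw [← hγ]
    induction h : (D f).orderTop using WithTop.recTopCoe with
    | top => simp
    | coe δ =>
      rw [h] at hpos
      have : (0 : Γ) < δ := by exact_mod_cast hpos
      rw [← WithTop.coe_add, WithTop.coe_lt_coe]
      exact lt_add_of_pos_left γ this

theorem lt_orderTop_bracket' {f g : HahnSeries Γ C} (hg : g ∈ Cont D) (hf : f ≠ 0) :
    f.orderTop < (bracket D f g).orderTop := by
  rw [bracket_swap, HahnSeries.orderTop_neg]
  exact lt_orderTop_bracket hg hf

theorem le_orderTop_bracket {f g : HahnSeries Γ C} (hf : f ∈ Cont D) :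
    g.orderTop ≤ (bracket D f g).orderTop := by
  rcases eq_or_ne g 0 with rfl | hg
  · simp [bracket_zero_right]
  · exact (lt_orderTop_bracket hf hg).le

/-- The two innermost letters contribute zero or the bracket up to sign, and the outer letters do
not increase the value in the dominance order. -/
theorem orderTop_bracket_le_nestedBracket {f g : HahnSeries Γ C} (hf : f ∈ Cont D)
    (hg : g ∈ Cont D) (l : List (HahnSeries Γ C)) (hl : ∀ a ∈ l, a = f ∨ a = g)
    (hlen : 2 ≤ l.length) :
    (bracket D f g).orderTop ≤ (BCH.nestedBracket (bracket D) l).orderTop := by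
  induction l with
  | nil => simp at hlen
  | cons a l ih =>
    have ha := hl a List.mem_cons_self
    rcases l with _ | ⟨b, l⟩
    · simp at hlen
    · rcases l with _ | ⟨c, l⟩
      · have hb := hl b (by simp)
        simp only [BCH.nestedBracket]
        rcases ha with rfl | rfl <;> rcases hb with rfl | rfl
        · simp [bracket_self]
        · exact le_rfl
        · rw [bracket_swap, HahnSeries.orderTop_neg]
        · simp [bracket_self]
      · refine (ih (fun d hd => hl d (List.mem_cons_of_mem _ hd)) (by simp)).trans ?_
        refine le_orderTop_bracket ?_
        rcases ha with rfl | rfl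
        · exact hf
        · exact hg

theorem orderTop_bracket_lt_nestedBracket {f g : HahnSeries Γ C} (hf : f ∈ Cont D)
    (hg : g ∈ Cont D) (hfg : bracket D f g ≠ 0) (l : List (HahnSeries Γ C))
    (hl : ∀ a ∈ l, a = f ∨ a = g) (hlen : 3 ≤ l.length) :
    (bracket D f g).orderTop < (BCH.nestedBracket (bracket D) l).orderTop := by
  obtain ⟨a, l, rfl⟩ := List.exists_cons_of_length_pos (by omega : 0 < l.length)
  obtain ⟨b, l, rfl⟩ := List.exists_cons_of_length_pos (by simp at hlen; omega : 0 < l.length)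
  have ha : a ∈ Cont D := by
    rcases hl a List.mem_cons_self with rfl | rfl
    · exact hf
    · exact hg
  have h1 := orderTop_bracket_le_nestedBracket hf hg (b :: l)
    (fun d hd => hl d (List.mem_cons_of_mem _ hd)) (by simp at hlen ⊢; omega)
  simp only [BCH.nestedBracket] at h1 ⊢
  rcases eq_or_ne (BCH.nestedBracket (bracket D) (b :: l)) 0 with h0 | h0
  · rw [h0, bracket_zero_right]
    simpa using hfg
  · exact h1.trans_lt (lt_orderTop_bracket ha h0)

theorem orderTop_bracket_le_term {f g : HahnSeries Γ C} (hf : f ∈ Cont D)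
    (hg : g ∈ Cont D) {n : ℕ} (hn : 2 ≤ n) :
    (bracket D f g).orderTop ≤ (BCH.term C (bracket D) f g n).orderTop := by
  have hadd : ∀ x y : HahnSeries Γ C, (bracket D f g).orderTop ≤ x.orderTop →
      (bracket D f g).orderTop ≤ y.orderTop → (bracket D f g).orderTop ≤ (x + y).orderTop :=
    fun _ _ hx hy => le_orderTop_add hx hy
  refine Finset.sum_induction _ _ hadd (by simp) fun k _ =>
    Finset.sum_induction _ _ hadd (by simp) fun p hp => ?_
  refine (orderTop_bracket_le_nestedBracket hf hg _ (fun a ha => BCH.mem_word ha) ?_).trans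
    (HahnSeries.orderTop_le_orderTop_smul _ _)
  rwa [BCH.length_word_of_mem_exponents f g hp]

theorem orderTop_bracket_lt_term {f g : HahnSeries Γ C} (hf : f ∈ Cont D)
    (hg : g ∈ Cont D) (hfg : bracket D f g ≠ 0) {n : ℕ} (hn : 3 ≤ n) :
    (bracket D f g).orderTop < (BCH.term C (bracket D) f g n).orderTop := by
  have hadd : ∀ x y : HahnSeries Γ C, (bracket D f g).orderTop < x.orderTop →
      (bracket D f g).orderTop < y.orderTop → (bracket D f g).orderTop < (x + y).orderTop :=
    fun _ _ hx hy => lt_orderTop_add hx hy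
  refine Finset.sum_induction _ _ hadd (by simpa using hfg) fun k _ =>
    Finset.sum_induction _ _ hadd (by simpa using hfg) fun p hp => ?_
  refine (orderTop_bracket_lt_nestedBracket hf hg hfg _ (fun a ha => BCH.mem_word ha) ?_).trans_le
    (HahnSeries.orderTop_le_orderTop_smul _ _)
  rwa [BCH.length_word_of_mem_exponents f g hp]

/-- The operator `f ∂`. -/
noncomputable def contOp (D : Derivation C (HahnSeries Γ C) (HahnSeries Γ C)) :
    HahnSeries Γ C →ₗ[C] Module.End C (HahnSeries Γ C) :=
  (LinearMap.mul C (HahnSeries Γ C)).compl₂ (D : HahnSeries Γ C →ₗ[C] HahnSeries Γ C)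

theorem contOp_apply (f h : HahnSeries Γ C) : contOp D f h = f * D h := rfl

theorem contOp_bracket (f g : HahnSeries Γ C) :
    contOp D (bracket D f g) = contOp D f * contOp D g - contOp D g * contOp D f := by
  ext1 h
  simp only [LinearMap.sub_apply, Module.End.mul_apply, contOp_apply, bracket, Derivation.leibniz,
    smul_eq_mul]
  ring

theorem contOp_mem_strongLinear (hD : CommutesWithSums D) (f : HahnSeries Γ C) :
    contOp D f ∈ strongLinear Γ C := fun I s h H => (hD I s h H).const_mul f

theorem isContracting_contOp {f : HahnSeries Γ C} (hf : f ∈ Cont D) :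
    IsContracting (contOp D f) := hf

variable [CharZero C]

theorem contOp_term (f g : HahnSeries Γ C) (n : ℕ) :
    contOp D (BCH.term C (bracket D) f g n) =
      BCH.assocTerm C (contOp D f) (contOp D g) n := by
  rw [BCH.map_term (b' := fun a b => a * b - b * a) (contOp D) contOp_bracket, BCH.assocTerm_eq_term]

end Bracket

/-! ### Existence of the product and its distance from the sum. -/

section Product

variable {Γ : Type u} {C : Type v} [AddCommGroup Γ] [LinearOrder Γ] [Field C]
  [IsOrderedAddMonoid Γ] {D : Derivation C (HahnSeries Γ C) (HahnSeries Γ C)}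

theorem exists_derivation_ne_zero [Nontrivial Γ]
    (hker : ∀ f : HahnSeries Γ C, D f = 0 ↔ ∃ c : C, f = HahnSeries.C c) : ∃ e, D e ≠ 0 := by
  obtain ⟨γ, hγ⟩ := exists_ne (0 : Γ)
  refine ⟨HahnSeries.single γ 1, fun h => ?_⟩
  obtain ⟨c, hc⟩ := (hker _).1 h
  have := congrArg (fun f => HahnSeries.coeff f γ) hc
  simp [HahnSeries.C_apply, HahnSeries.coeff_single_of_ne hγ] at this

theorem contOp_injective {e : HahnSeries Γ C} (he : D e ≠ 0) : Function.Injective (contOp D) := by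
  intro f g hfg
  have := LinearMap.congr_fun hfg e
  rw [contOp_apply, contOp_apply] at this
  exact mul_right_cancel₀ he this

variable [CharZero C]

/-- The operator series is summable at `e`, where its terms are the homogeneous parts times `∂e`;
dividing by `∂e` keeps it summable. -/
theorem exists_isBCHProduct (hD : CommutesWithSums D) {e : HahnSeries Γ C} (he : D e ≠ 0)
    {f g : HahnSeries Γ C} (hf : f ∈ Cont D) (hg : g ∈ Cont D) : ∃ h, IsBCHProduct D f g h := by
  obtain ⟨k, hk⟩ := isGraded_bchSeries.exists_hasValue (contOp_mem_strongLinear hD f)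
    (contOp_mem_strongLinear hD g) (isContracting_contOp hf) (isContracting_contOp hg) e
  refine ⟨k * (D e)⁻¹, ?_⟩
  have h := HasHahnSum.mul_const hk (D e)⁻¹
  have e1 : ∀ n, PowerSeries.coeff n (BCH.bchSeries C (contOp D f) (contOp D g)) e * (D e)⁻¹ =
      BCH.term C (bracket D) f g n := by
    intro n
    rw [BCH.bchSeries, PowerSeries.coeff_mk, ← contOp_term, contOp_apply,
      mul_inv_cancel_right₀ he]
  simp only [e1] at h
  exact h

theorem IsBCHProduct.hasValue {f g h : HahnSeries Γ C} (H : IsBCHProduct D f g h)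
    (k : HahnSeries Γ C) :
    HasValue (BCH.bchSeries C (contOp D f) (contOp D g)) k (contOp D h k) := by
  have h1 := HasHahnSum.mul_const H (D k)
  have e1 : ∀ n, PowerSeries.coeff n (BCH.bchSeries C (contOp D f) (contOp D g)) k =
      BCH.term C (bracket D) f g n * D k := by
    intro n
    rw [BCH.bchSeries, PowerSeries.coeff_mk, ← contOp_term, contOp_apply]
  simp only [HasValue, e1]
  exact h1

theorem term_zero (f g : HahnSeries Γ C) : BCH.term C (bracket D) f g 0 = 0 := by
  simp [BCH.term]

theorem term_one {e : HahnSeries Γ C} (he : D e ≠ 0) (f g : HahnSeries Γ C) :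
    BCH.term C (bracket D) f g 1 = f + g := by
  apply contOp_injective he
  rw [contOp_term, BCH.assocTerm_one, map_add]

theorem term_two {e : HahnSeries Γ C} (he : D e ≠ 0) (f g : HahnSeries Γ C) :
    (2 : C) • BCH.term C (bracket D) f g 2 = bracket D f g := by
  apply contOp_injective he
  rw [map_smul, contOp_term, BCH.two_smul_assocTerm_two, contOp_bracket]

variable {e : HahnSeries Γ C} (he : D e ≠ 0) {f g h : HahnSeries Γ C} (hf : f ∈ Cont D)
  (hg : g ∈ Cont D)

include he hf hg

theorem IsBCHProduct.le_orderTop_sub (H : IsBCHProduct D f g h) :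
    (bracket D f g).orderTop ≤ (h - (f + g)).orderTop := by
  rw [HahnSeries.le_orderTop_iff_forall]
  intro δ hδ
  rw [HahnSeries.coeff_sub, sub_eq_zero, HasHahnSum.coeff_eq_sum_range (N := 2) H fun n hn =>
    HahnSeries.coeff_eq_zero_of_lt_orderTop (hδ.trans_le (orderTop_bracket_le_term hf hg hn))]
  rw [Finset.sum_range_succ, Finset.sum_range_one, term_zero, term_one he]
  simp

/-- The term of degree two is half the bracket, and all later terms are strictly smaller. This
detects a nonzero bracket in the product. -/
theorem IsBCHProduct.lt_orderTop_sub (H : IsBCHProduct D f g h) (hfg : bracket D f g ≠ 0) :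
    (bracket D f g).orderTop < ((2 : C) • (h - (f + g)) - bracket D f g).orderTop := by
  obtain ⟨γ, hγ⟩ := WithTop.ne_top_iff_exists.1 (HahnSeries.orderTop_ne_top.2 hfg)
  have hle : ∀ δ ≤ γ, ((2 : C) • (h - (f + g)) - bracket D f g).coeff δ = 0 := by
    intro δ hδ
    have h2 := congrArg (fun x => HahnSeries.coeff x δ) (term_two he f g)
    rw [HahnSeries.coeff_sub, HahnSeries.coeff_smul, HahnSeries.coeff_sub,
      HasHahnSum.coeff_eq_sum_range (N := 3) H fun n hn =>
        HahnSeries.coeff_eq_zero_of_lt_orderTop (lt_of_le_of_lt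
          ((WithTop.coe_le_coe.2 hδ).trans hγ.le) (orderTop_bracket_lt_term hf hg hfg hn))]
    simp only [HahnSeries.coeff_smul] at h2
    rw [Finset.sum_range_succ, Finset.sum_range_succ, Finset.sum_range_one, term_zero, term_one he,
      ← h2]
    simp
  rw [← hγ, ← not_le]
  intro hcon
  obtain ⟨δ, hδ⟩ := WithTop.ne_top_iff_exists.1 (ne_top_of_le_ne_top (WithTop.coe_ne_top) hcon)
  rw [← hδ, WithTop.coe_le_coe] at hcon
  exact HahnSeries.coeff_orderTop_ne hδ.symm (hle δ hcon)

theorem IsBCHProduct.mem_Cont (H : IsBCHProduct D f g h) : h ∈ Cont D := by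
  have h1 := H.le_orderTop_sub he hf hg
  have h2 : h - (f + g) ∈ Cont D := mem_Cont_of_le hg ((le_orderTop_bracket hf).trans h1)
  simpa using add_mem_Cont h2 (add_mem_Cont hf hg)

theorem isBCHProduct_add_of_bracket_eq_zero (hD : CommutesWithSums D) (hfg : bracket D f g = 0) :
    IsBCHProduct D f g (f + g) := by
  obtain ⟨h, H⟩ := exists_isBCHProduct hD he hf hg
  have h1 := H.le_orderTop_sub he hf hg
  rw [hfg, HahnSeries.orderTop_zero, top_le_iff, HahnSeries.orderTop_eq_top, sub_eq_zero] at h1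
  rwa [← h1]

end Product

/-! ### Faithfulness of the exponential. -/

section Exponential

variable {Γ : Type u} {C : Type v} [AddCommGroup Γ] [LinearOrder Γ] [Field C]
  [IsOrderedAddMonoid Γ] {D : Derivation C (HahnSeries Γ C) (HahnSeries Γ C)}

open Classical in
/-- The exponential of the operator `f ∂`, evaluated at `k` (and `0` where the exponential series
is not summable). -/
noncomputable def expOp (D : Derivation C (HahnSeries Γ C) (HahnSeries Γ C))
    (f k : HahnSeries Γ C) : HahnSeries Γ C :=
  if h : ∃ l, HasValue (BCH.expSeries C (contOp D f)) k l then h.choose else 0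

theorem expOp_eq {f k l : HahnSeries Γ C} (h : HasValue (BCH.expSeries C (contOp D f)) k l) :
    expOp D f k = l := by
  have hex : ∃ l, HasValue (BCH.expSeries C (contOp D f)) k l := ⟨l, h⟩
  rw [expOp, dif_pos hex]
  exact hex.choose_spec.unique h

theorem expOp_zero (k : HahnSeries Γ C) : expOp D 0 k = k := by
  refine HahnField.expOp_eq ⟨HahnSeries.SummableFamily.single 0 k, ?_,
    HahnSeries.SummableFamily.hsum_single _ _⟩
  ext1 n
  rw [HahnSeries.SummableFamily.single_toFun, map_zero, BCH.expSeries, PowerSeries.coeff_mk]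
  rcases eq_or_ne n 0 with rfl | hn
  · simp
  · simp [hn]

variable (hD : CommutesWithSums D)

include hD

theorem hasValue_expOp {f : HahnSeries Γ C} (hf : f ∈ Cont D) (k : HahnSeries Γ C) :
    HasValue (BCH.expSeries C (contOp D f)) k (expOp D f k) := by
  have hX := contOp_mem_strongLinear hD f
  have hX' := isContracting_contOp hf
  obtain ⟨l, hl⟩ := (isGraded_expSeries (X := contOp D f) (Y := contOp D f)
    (Or.inl rfl)).exists_hasValue hX hX hX' hX' k
  rwa [expOp_eq hl]

/-- For nonzero `f`, the difference of `exp (f∂) e` and `e` has the leading term of `f ∂(e)`,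
because higher powers of `f∂` are strictly smaller at `e`. -/
theorem eq_zero_of_expOp_eq {e : HahnSeries Γ C} (he : D e ≠ 0) {f : HahnSeries Γ C}
    (hf : f ∈ Cont D) (h : expOp D f e = e) : f = 0 := by
  by_contra hne
  set w := contOp D f e with hw
  have hw0 : w ≠ 0 := mul_ne_zero hne he
  obtain ⟨γ, hγ⟩ := WithTop.ne_top_iff_exists.1 (HahnSeries.orderTop_ne_top.2 hw0)
  have hpow : ∀ n, w.orderTop < ((contOp D f ^ (n + 2)) e).orderTop := by
    intro n
    have hstep : ∀ x : HahnSeries Γ C, w.orderTop ≤ x.orderTop →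
        w.orderTop < (contOp D f x).orderTop := by
      intro x hx
      rcases eq_or_ne x 0 with rfl | hx0
      · simpa using hw0
      · exact hx.trans_lt (HahnField.mem_Cont.1 hf x hx0)
    induction n with
    | zero =>
      rw [pow_succ', pow_one]
      exact hstep _ le_rfl
    | succ n ih =>
      rw [pow_succ']
      exact hstep _ ih.le
  have hv := hasValue_expOp hD hf e
  rw [h] at hv
  have h1 := hv.coeff_eq_sum_range (δ := γ) (N := 2) fun n hn => by
    obtain ⟨m, rfl⟩ := Nat.exists_eq_add_of_le' hn
    rw [BCH.expSeries, PowerSeries.coeff_mk, LinearMap.smul_apply, HahnSeries.coeff_smul,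
      HahnSeries.coeff_eq_zero_of_lt_orderTop (hγ.trans_lt (hpow m)), smul_zero]
  rw [Finset.sum_range_succ, Finset.sum_range_one, BCH.expSeries, PowerSeries.coeff_mk,
    PowerSeries.coeff_mk] at h1
  simp only [Nat.factorial, Nat.cast_one, inv_one, pow_zero, one_smul, pow_one, mul_one,
    Module.End.one_apply, left_eq_add] at h1
  exact HahnSeries.coeff_orderTop_ne hγ.symm h1

variable [CharZero C]

theorem IsBCHProduct.expOp_eq {e : HahnSeries Γ C} (he : D e ≠ 0) {f g h : HahnSeries Γ C}
    (hf : f ∈ Cont D) (hg : g ∈ Cont D) (H : IsBCHProduct D f g h) (k : HahnSeries Γ C) :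
    expOp D h k = expOp D f (expOp D g k) :=
  HasValue.exp_bchSeries (contOp_mem_strongLinear hD f) (contOp_mem_strongLinear hD g)
    (isContracting_contOp hf) (isContracting_contOp hg) H.hasValue (hasValue_expOp hD hg k)
    (hasValue_expOp hD hf _) (hasValue_expOp hD (H.mem_Cont he hf hg) k)

theorem expOp_injective {e : HahnSeries Γ C} (he : D e ≠ 0) {f g : HahnSeries Γ C}
    (hf : f ∈ Cont D) (hg : g ∈ Cont D) (h : ∀ k, expOp D f k = expOp D g k) : f = g := by
  have hf' := neg_mem_Cont hf
  obtain ⟨k, hk⟩ := exists_isBCHProduct hD he hf' hg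
  have hcancel : IsBCHProduct D (-f) f 0 := by
    have := isBCHProduct_add_of_bracket_eq_zero he hf' hf hD
      (by rw [bracket_neg_left, bracket_self, neg_zero])
    rwa [neg_add_cancel] at this
  have hk0 : k = 0 := by
    refine eq_zero_of_expOp_eq hD he (hk.mem_Cont he hf' hg) ?_
    rw [hk.expOp_eq hD he hf' hg, ← h, ← hcancel.expOp_eq hD he hf' hf, expOp_zero]
  by_contra hne
  -- No group law is available yet, so `(-f) * g = 0` must yield `f = g` by valuation: the bracket
  -- of `-f` and `g` is that of `-f` and `g - f`, hence strictly smaller than `g - f`, which it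
  -- should dominate.
  have h1 := hk.le_orderTop_sub he hf' hg
  have hu : g - f ≠ 0 := sub_ne_zero.2 (Ne.symm hne)
  have h2 : bracket D (-f) g = bracket D (-f) (g - f) := by
    simp only [bracket, map_neg, map_sub]; ring
  have h3 := lt_orderTop_bracket hf' hu
  rw [hk0, zero_sub, HahnSeries.orderTop_neg, h2, show -f + g = g - f by ring] at h1
  exact not_le.2 h3 h1

end Exponential

end HahnField

/-! ### The group and its dominance relation. -/

namespace HahnField

universe u v

variable {Γ : Type u} {C : Type v} [AddCommGroup Γ] [LinearOrder Γ] [IsOrderedAddMonoid Γ]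
  [Field C] {D : Derivation C (HahnSeries Γ C) (HahnSeries Γ C)}

theorem strictlyDominated_contDominated {f g : Cont D} :
    ValuedGroup.StrictlyDominated (contDominated D) f g ↔
      (g : HahnSeries Γ C).orderTop < (f : HahnSeries Γ C).orderTop :=
  strictlyDominated_iff (f := (f : HahnSeries Γ C))

/-- Pseudo-completeness of Hahn series: compatible truncations have a common extension. -/
theorem exists_forall_lt_orderTop_sub {I : Type*} (g : I → HahnSeries Γ C) (ρ : I → Γ)
    (hcomp : ∀ i j, ∀ γ ≤ ρ i, γ ≤ ρ j → (g i).coeff γ = (g j).coeff γ) :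
    ∃ h : HahnSeries Γ C, ∀ i, (ρ i : WithTop Γ) < (h - g i).orderTop := by
  classical
  let c : Γ → C := fun γ => if hγ : ∃ i, γ ≤ ρ i then (g hγ.choose).coeff γ else 0
  have hc : ∀ i, ∀ γ ≤ ρ i, c γ = (g i).coeff γ := by
    intro i γ hγ
    have hex : ∃ i, γ ≤ ρ i := ⟨i, hγ⟩
    simp only [c, dif_pos hex]
    exact hcomp _ _ _ hex.choose_spec hγ
  have hsupp : ∀ γ, c γ ≠ 0 → ∃ i, γ ≤ ρ i := by
    intro γ hγ
    by_contra hex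
    exact hγ (dif_neg hex)
  have hpwo : (Function.support c).IsPWO := by
    rw [Set.isPWO_iff_isWF, Set.isWF_iff_no_descending_seq]
    intro f hf hmem
    obtain ⟨i, hi⟩ := hsupp _ (hmem 0)
    -- A descending sequence of exponents stays below the `ρ i` that bounds its first member, where
    -- the coefficients are those of `g i`.
    refine (Set.isWF_iff_no_descending_seq.1 (g i).isWF_support) f hf fun n => ?_
    have : f n ≤ ρ i := (hf.antitone n.zero_le).trans hi
    rw [HahnSeries.mem_support, ← hc i _ this]
    exact hmem n
  refine ⟨⟨c, hpwo⟩, fun i => ?_⟩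
  by_contra hle
  rw [not_lt] at hle
  obtain ⟨δ, hδ⟩ := WithTop.ne_top_iff_exists.1 (ne_top_of_le_ne_top WithTop.coe_ne_top hle)
  rw [← hδ, WithTop.coe_le_coe] at hle
  refine HahnSeries.coeff_orderTop_ne hδ.symm ?_
  rw [HahnSeries.coeff_sub, sub_eq_zero]
  exact hc i δ hle

theorem coe_ne_zero [Group (Cont D)] (hone : ((1 : Cont D) : HahnSeries Γ C) = 0)
    {f : Cont D} : (f : HahnSeries Γ C) ≠ 0 ↔ f ≠ 1 := by
  rw [← hone, Ne, Ne, Subtype.ext_iff]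

variable [CharZero C]

/-- The group of all `f` with `f ∂` contracting, under the Baker-Campbell-Hausdorff product. -/
theorem exists_group_Cont (hD : CommutesWithSums D) {e : HahnSeries Γ C} (he : D e ≠ 0) :
    ∃ _ : Group (Cont D), (∀ f g : Cont D,
      IsBCHProduct D (f : HahnSeries Γ C) g ((f * g : Cont D) : HahnSeries Γ C)) ∧
      ((1 : Cont D) : HahnSeries Γ C) = 0 := by
  have hex : ∀ f g : Cont D, ∃ h : Cont D, IsBCHProduct D (f : HahnSeries Γ C) g h := by
    intro f g
    obtain ⟨h, hh⟩ := exists_isBCHProduct hD he f.2 g.2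
    exact ⟨⟨h, hh.mem_Cont he f.2 g.2⟩, hh⟩
  choose m hm using hex
  have hexp : ∀ (f g : Cont D) k, expOp D (m f g) k = expOp D f (expOp D g k) := fun f g k =>
    (hm f g).expOp_eq hD he f.2 g.2 k
  have hinj : ∀ f g : Cont D, (∀ k, expOp D f k = expOp D g k) → f = g := fun f g h =>
    Subtype.ext (expOp_injective hD he f.2 g.2 h)
  let _ : Mul (Cont D) := ⟨m⟩
  let _ : One (Cont D) := ⟨⟨0, zero_mem_Cont⟩⟩
  let _ : Inv (Cont D) := ⟨fun f => ⟨-f, neg_mem_Cont f.2⟩⟩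
  -- Associativity and the unit law are inherited from composition through the faithful exponential.
  -- For inverses, `-f` and `f` have zero bracket, so their product is their sum.
  refine ⟨Group.ofLeftAxioms ?_ ?_ ?_, hm, rfl⟩
  · intro f g h
    refine hinj _ _ fun k => ?_
    change expOp D (m (m f g) h) k = expOp D (m f (m g h)) k
    rw [hexp, hexp, hexp, hexp]
  · intro f
    refine hinj _ _ fun k => ?_
    change expOp D (m ⟨0, zero_mem_Cont⟩ f) k = _
    rw [hexp]
    exact expOp_zero _
  · intro f
    have h := isBCHProduct_add_of_bracket_eq_zero he (neg_mem_Cont f.2) f.2 hD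
      (by rw [bracket_neg_left, bracket_self, neg_zero])
    rw [neg_add_cancel] at h
    exact Subtype.ext ((hm ⟨-f, neg_mem_Cont f.2⟩ f).unique h)

section Group

variable [Group (Cont D)] (hD : CommutesWithSums D) {e : HahnSeries Γ C} (he : D e ≠ 0)
  (hmul : ∀ f g : Cont D,
    IsBCHProduct D (f : HahnSeries Γ C) g ((f * g : Cont D) : HahnSeries Γ C))
  (hone : ((1 : Cont D) : HahnSeries Γ C) = 0)

include he hmul in
-- Twice the correction terms of `f * g` and `g * f` are asymptotic to the bracket and to its
-- negative. If the products agree, twice the bracket is strictly smaller than the bracket.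
theorem bracket_eq_zero_of_commute {f g : Cont D} (h : g * f = f * g) :
    bracket D (f : HahnSeries Γ C) g = 0 := by
  by_contra hne
  have hne' : bracket D (g : HahnSeries Γ C) f ≠ 0 := by rwa [bracket_swap, neg_ne_zero]
  have h1 := (hmul f g).lt_orderTop_sub he f.2 g.2 hne
  have h2 := (hmul g f).lt_orderTop_sub he g.2 f.2 hne'
  rw [bracket_swap (f : HahnSeries Γ C) g, HahnSeries.orderTop_neg, h] at h2
  have h3 := lt_orderTop_sub h2 h1
  have h4 : (2 : C) • ((((f * g : Cont D) : HahnSeries Γ C)) - (g + f)) - -bracket D f g -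
      ((2 : C) • ((((f * g : Cont D) : HahnSeries Γ C)) - (f + g)) - bracket D f g) =
      (2 : C) • bracket D (f : HahnSeries Γ C) g := by
    rw [add_comm (g : HahnSeries Γ C), two_smul C (bracket D (f : HahnSeries Γ C) g)]
    abel
  rw [h4] at h3
  have h5 := HahnSeries.orderTop_le_orderTop_smul ((2 : C)⁻¹)
    ((2 : C) • bracket D (f : HahnSeries Γ C) g)
  rw [smul_smul, inv_mul_cancel₀ two_ne_zero, one_smul] at h5
  exact not_le.2 h3 h5

include hD he hmul hone in
theorem coe_inv (f : Cont D) : ((f⁻¹ : Cont D) : HahnSeries Γ C) = -f := by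
  have h := isBCHProduct_add_of_bracket_eq_zero he (neg_mem_Cont f.2) f.2 hD
    (by rw [bracket_neg_left, bracket_self, neg_zero])
  rw [neg_add_cancel, ← hone] at h
  have : (⟨-f, neg_mem_Cont f.2⟩ : Cont D) * f = 1 := Subtype.ext ((hmul _ f).unique h)
  rw [← eq_inv_of_mul_eq_one_left this]

include hD he hmul hone

/-- The bracket is unchanged when `f` is replaced by `f - g` in the second argument, so the
correction is strictly smaller than `f - g`. -/
theorem lt_orderTop_inv_mul_sub {f g : Cont D} (hfg : f ≠ g) :
    (f - g : HahnSeries Γ C).orderTop <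
      (((g⁻¹ * f : Cont D) : HahnSeries Γ C) - (f - g)).orderTop := by
  have h1 := (hmul g⁻¹ f).le_orderTop_sub he g⁻¹.2 f.2
  have h2 : bracket D ((g⁻¹ : Cont D) : HahnSeries Γ C) f = -bracket D g (f - g) := by
    rw [coe_inv hD he hmul hone, bracket_neg_left]
    simp only [bracket, map_sub]; ring
  rw [h2, HahnSeries.orderTop_neg, coe_inv hD he hmul hone, neg_add_eq_sub] at h1
  exact (lt_orderTop_bracket g.2 (sub_ne_zero.2 fun h => hfg (Subtype.ext h))).trans_le h1

theorem lt_orderTop_mul_inv_sub {f g : Cont D} (hfg : f ≠ g) :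
    (f - g : HahnSeries Γ C).orderTop <
      (((f * g⁻¹ : Cont D) : HahnSeries Γ C) - (f - g)).orderTop := by
  have h1 := (hmul f g⁻¹).le_orderTop_sub he f.2 g⁻¹.2
  have h2 : bracket D f ((g⁻¹ : Cont D) : HahnSeries Γ C) = -bracket D (f - g) g := by
    rw [coe_inv hD he hmul hone, bracket_neg_right]
    simp only [bracket, map_sub]; ring
  rw [h2, HahnSeries.orderTop_neg, coe_inv hD he hmul hone, ← sub_eq_add_neg] at h1
  exact (lt_orderTop_bracket' g.2 (sub_ne_zero.2 fun h => hfg (Subtype.ext h))).trans_le h1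

theorem orderTop_inv_mul (f g : Cont D) :
    ((g⁻¹ * f : Cont D) : HahnSeries Γ C).orderTop = (f - g : HahnSeries Γ C).orderTop := by
  rcases eq_or_ne f g with rfl | hfg
  · rw [inv_mul_cancel, hone, sub_self]
  · exact orderTop_eq_of_lt_sub (lt_orderTop_inv_mul_sub hD he hmul hone hfg)

theorem orderTop_mul_inv (f g : Cont D) :
    ((f * g⁻¹ : Cont D) : HahnSeries Γ C).orderTop = (f - g : HahnSeries Γ C).orderTop := by
  rcases eq_or_ne f g with rfl | hfg
  · rw [mul_inv_cancel, hone, sub_self]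
  · exact orderTop_eq_of_lt_sub (lt_orderTop_mul_inv_sub hD he hmul hone hfg)

/-- Conjugation does not change the leading term. -/
theorem lt_orderTop_conj_sub (f h : Cont D) (hf : f ≠ 1) :
    (f : HahnSeries Γ C).orderTop < (((h * f * h⁻¹ : Cont D) : HahnSeries Γ C) - f).orderTop := by
  have hf0 := (coe_ne_zero hone).2 hf
  have h1 := (lt_orderTop_bracket h.2 hf0).trans_le ((hmul h f).le_orderTop_sub he h.2 f.2)
  have h2 : (f : HahnSeries Γ C).orderTop <
      (((h * f : Cont D) : HahnSeries Γ C) - h - f).orderTop := by rwa [sub_sub]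
  have hne : h * f ≠ h := by simpa using hf
  have h3 := lt_orderTop_mul_inv_sub hD he hmul hone hne
  -- The quotient of `h * f` by `h` has the leading term of their difference, which is that of `f`.
  rw [orderTop_eq_of_lt_sub h2] at h3
  simpa using lt_orderTop_add h3 h2

theorem lt_orderTop_comm_left (f g : Cont D) (hf : f ≠ 1) :
    (f : HahnSeries Γ C).orderTop < ((ValuedGroup.comm f g : Cont D) : HahnSeries Γ C).orderTop := by
  have h := lt_orderTop_conj_sub hD he hmul hone f g⁻¹ hf
  rw [inv_inv] at h
  rwa [ValuedGroup.comm, show f⁻¹ * g⁻¹ * f * g = f⁻¹ * (g⁻¹ * f * g) by group,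
    orderTop_inv_mul hD he hmul hone]

theorem lt_orderTop_comm_right (f g : Cont D) (hg : g ≠ 1) :
    (g : HahnSeries Γ C).orderTop < ((ValuedGroup.comm f g : Cont D) : HahnSeries Γ C).orderTop := by
  have h := lt_orderTop_conj_sub hD he hmul hone g f⁻¹ hg
  rw [inv_inv, lt_orderTop_sub_comm] at h
  rwa [ValuedGroup.comm, show f⁻¹ * g⁻¹ * f * g = (f⁻¹ * g * f)⁻¹ * g by group,
    orderTop_inv_mul hD he hmul hone]

theorem isNearlyAbelian_Cont : ValuedGroup.IsNearlyAbelian (contDominated D) := fun f g hf hg =>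
  ⟨strictlyDominated_contDominated.2 (lt_orderTop_comm_left hD he hmul hone f g hf),
    strictlyDominated_contDominated.2 (lt_orderTop_comm_right hD he hmul hone f g hg)⟩

theorem isCDominance_Cont
    (hker : ∀ f : HahnSeries Γ C, D f = 0 ↔ ∃ c : C, f = HahnSeries.C c) :
    ValuedGroup.IsCDominance (contDominated D) where
  refl _ := le_rfl
  trans _ _ _ hfg hgh := le_trans hgh hfg
  total _ _ := le_total _ _
  one_lt f hf := by
    rw [strictlyDominated_contDominated, hone, HahnSeries.orderTop_zero,
      HahnSeries.orderTop_lt_top]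
    exact (coe_ne_zero hone).2 hf
  mul_le f g := by
    have h1 := (le_orderTop_bracket f.2).trans ((hmul f g).le_orderTop_sub he f.2 g.2)
    have h2 := HahnSeries.min_orderTop_le_orderTop_add (x := (f : HahnSeries Γ C))
      (y := (g : HahnSeries Γ C))
    have h3 := le_orderTop_add ((min_le_right _ _).trans h1) h2
    rw [sub_add_cancel] at h3
    exact min_le_iff.1 h3
  conj_le f g h hfg := by
    have hconj : ∀ f : Cont D, ((h * f * h⁻¹ : Cont D) : HahnSeries Γ C).orderTop =
        (f : HahnSeries Γ C).orderTop := by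
      intro f
      rcases eq_or_ne f 1 with rfl | hf
      · simp
      · exact orderTop_eq_of_lt_sub (lt_orderTop_conj_sub hD he hmul hone f h hf)
    rw [contDominated, Dominated, hconj, hconj]
    exact hfg
  inv_same f := by
    rw [ValuedGroup.SameValue, contDominated, contDominated, Dominated, Dominated,
      coe_inv hD he hmul hone, HahnSeries.orderTop_neg]
    exact ⟨le_rfl, le_rfl⟩
  same_of_commute f g hcomm hf hg := by
    have hf0 := (coe_ne_zero hone).2 hf
    have hg0 := (coe_ne_zero hone).2 hg
    have hb := bracket_eq_zero_of_commute he hmul hcomm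
    obtain ⟨q, hq⟩ : ∃ q : HahnSeries Γ C, (g : HahnSeries Γ C) = q * f :=
      ⟨g * (f : HahnSeries Γ C)⁻¹, (inv_mul_cancel_right₀ hf0 _).symm⟩
    -- With `g = q f` the bracket is `f² ∂(q)`.
    have hDq : D q = 0 := by
      rw [bracket, hq, Derivation.leibniz, smul_eq_mul, smul_eq_mul] at hb
      have : (f : HahnSeries Γ C) * f * D q = 0 := by linear_combination hb
      simpa [hf0] using this
    obtain ⟨c, rfl⟩ := (hker q).1 hDq
    have hc : c ≠ 0 := by
      rintro rfl
      rw [map_zero, zero_mul] at hq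
      exact hg0 hq
    have : (g : HahnSeries Γ C).orderTop = (f : HahnSeries Γ C).orderTop := by
      rw [hq, HahnSeries.orderTop_mul, HahnSeries.C_apply, HahnSeries.orderTop_single hc,
        WithTop.coe_zero, zero_add]
    exact ⟨this.ge, this.le⟩
  comm_lt f g _ hf _ :=
    strictlyDominated_contDominated.2 (lt_orderTop_comm_left hD he hmul hone f g hf)

/-- Right and left balls are the balls of the additive group. -/
theorem exists_ball_eq {B : Set (Cont D)} (hB : ValuedGroup.IsBall (contDominated D) B) :
    ∃ g r : Cont D, (r : HahnSeries Γ C) ≠ 0 ∧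
      B = {h : Cont D | (r : HahnSeries Γ C).orderTop < (h - g : HahnSeries Γ C).orderTop} := by
  obtain ⟨g, r, hr, rfl | rfl⟩ := hB
  · refine ⟨g, r, (coe_ne_zero hone).2 hr, Set.ext fun h => ?_⟩
    rw [ValuedGroup.rightBall, Set.mem_ofPred_eq, strictlyDominated_contDominated,
      orderTop_inv_mul hD he hmul hone, Set.mem_ofPred_eq]
  · refine ⟨g, r, (coe_ne_zero hone).2 hr, Set.ext fun h => ?_⟩
    rw [ValuedGroup.leftBall, Set.mem_ofPred_eq, strictlyDominated_contDominated,
      orderTop_mul_inv hD he hmul hone, Set.mem_ofPred_eq]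

end Group

/-! ### Spherical completeness. -/

theorem isSphericallyComplete_Cont [Group (Cont D)] (hD : CommutesWithSums D)
    {e : HahnSeries Γ C} (he : D e ≠ 0) (hmul : ∀ f g : Cont D,
      IsBCHProduct D (f : HahnSeries Γ C) g ((f * g : Cont D) : HahnSeries Γ C))
    (hone : ((1 : Cont D) : HahnSeries Γ C) = 0) :
    ValuedGroup.IsSphericallyComplete (contDominated D) := by
  intro S hS hchain
  rcases S.eq_empty_or_nonempty with rfl | ⟨B₀, hB₀⟩
  · exact ⟨1, by simp⟩
  -- That the radius is the value of an element of `Cont(∂)` is retained, because it will put the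
  -- common point in `Cont(∂)`.
  have hball : ∀ B : S, ∃ (g : Cont D) (γ : Γ), (∃ r ∈ Cont D, r.orderTop = γ) ∧
      (B : Set (Cont D)) = {h : Cont D | (γ : WithTop Γ) < (h - g : HahnSeries Γ C).orderTop} := by
    intro B
    obtain ⟨g, r, hr, hB⟩ := exists_ball_eq hD he hmul hone (hS B B.2)
    obtain ⟨γ, hγ⟩ := WithTop.ne_top_iff_exists.1 (HahnSeries.orderTop_ne_top.2 hr)
    exact ⟨g, γ, ⟨r, r.2, hγ.symm⟩, by rw [hB, hγ]⟩
  choose g ρ hρ hB using hball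
  have hmem : ∀ B : S, g B ∈ (B : Set (Cont D)) := by
    intro B
    rw [hB, Set.mem_ofPred_eq, sub_self, HahnSeries.orderTop_zero]
    exact WithTop.coe_lt_top _
  have hcomp : ∀ A B : S, (A : Set (Cont D)) ⊆ B → ∀ γ ≤ ρ B,
      (g A : HahnSeries Γ C).coeff γ = (g B : HahnSeries Γ C).coeff γ := by
    intro A B hAB γ hγ
    have h1 := hAB (hmem A)
    rw [hB, Set.mem_ofPred_eq] at h1
    rw [← sub_eq_zero, ← HahnSeries.coeff_sub]
    exact HahnSeries.coeff_eq_zero_of_lt_orderTop ((WithTop.coe_le_coe.2 hγ).trans_lt h1)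
  obtain ⟨h, hh⟩ := exists_forall_lt_orderTop_sub (fun B : S => (g B : HahnSeries Γ C)) ρ
    fun A B γ hA hB => by
      rcases hchain.total A.2 B.2 with hAB | hBA
      · exact hcomp A B hAB γ hB
      · exact (hcomp B A hBA γ hA).symm
  -- The common extension differs from a centre by something dominated by an element of `Cont(∂)`.
  have hmemh : h ∈ Cont D := by
    obtain ⟨r, hr, hrρ⟩ := hρ ⟨B₀, hB₀⟩
    have h1 := mem_Cont_of_le hr (hrρ.le.trans (hh ⟨B₀, hB₀⟩).le)
    simpa using add_mem_Cont h1 (g ⟨B₀, hB₀⟩).2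
  refine ⟨⟨h, hmemh⟩, fun B hBS => ?_⟩
  have h1 := hB ⟨B, hBS⟩
  change B = _ at h1
  rw [h1]
  exact hh ⟨B, hBS⟩

end HahnField

theorem proposition7p18 {Γ : Type*} {C : Type*}
    [AddCommGroup Γ] [LinearOrder Γ] [IsOrderedAddMonoid Γ] [Nontrivial Γ]
    [Field C] [CharZero C]
    (D : Derivation C (HahnSeries Γ C) (HahnSeries Γ C))
    (hD : HahnField.CommutesWithSums D)
    (hker : ∀ f : HahnSeries Γ C, D f = 0 ↔ ∃ c : C, f = HahnSeries.C c) :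
    ∃ _ : Group (HahnField.Cont D),
      (∀ f g : HahnField.Cont D,
        HahnField.IsBCHProduct D (f : HahnSeries Γ C) (g : HahnSeries Γ C)
          ((f * g : HahnField.Cont D) : HahnSeries Γ C)) ∧
      (((1 : HahnField.Cont D) : HahnSeries Γ C) = 0) ∧
      ValuedGroup.IsCDominance (HahnField.contDominated D) ∧
      ValuedGroup.IsNearlyAbelian (HahnField.contDominated D) ∧
      ValuedGroup.IsSphericallyComplete (HahnField.contDominated D) := by
  obtain ⟨e, he⟩ := HahnField.exists_derivation_ne_zero hker
  obtain ⟨inst, hmul, hone⟩ := HahnField.exists_group_Cont hD he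
  exact ⟨inst, hmul, hone, HahnField.isCDominance_Cont hD he hmul hone hker,
    HahnField.isNearlyAbelian_Cont hD he hmul hone,
    HahnField.isSphericallyComplete_Cont hD he hmul hone⟩
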